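/- Let $K$ be a field of characteristic $0$ and let $F_3$ be the free metabelian unitary associative $K$-algebra on $x_1,x_2,x_3$, i.e. the free associative algebra $K\langle x_1,x_2,x_3\rangle$ modulo all the identities $[p,q][r,s]=0$, where $[p,q]=pq-qp$. Let $F_3'$ be its commutator ideal (the two-sided ideal generated by all commutators). The polynomial algebra $K[U_3,V_3]=K[u_1,u_2,u_3,v_1,v_2,v_3]$ acts on $F_3'$ by $wu_i=x_iw$ and $wv_i=[w,x_i]$, $w\in F_3'$. Let $\delta$ be the derivation of $F_3$ with $\delta(x_1)=0$, $\delta(x_2)=x_1$, $\delta(x_3)=x_2$, and let $\delta$ also denote the derivation of $K[U_3,V_3]$ with $\delta(u_1)=\delta(v_1)=0$, $\delta(u_2)=u_1$, $\delta(u_3)=u_2$, $\delta(v_2)=v_1$, $\delta(v_3)=v_2$. A superscript $\delta$ denotes the kernel of $\delta$ (the constants); thus $(F_3')^\delta$ is a $K[U_3,V_3]^\delta$-module. Put \[ f_1=u_1,\quad f_2=v_1,\quad f_3=u_2^2-2u_1u_3,\quad f_4=v_2^2-2v_1v_3,\quad f_5=u_1v_3-u_2v_2+u_3v_1,\quad f_6=u_1v_2-u_2v_1,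 \] \[ c_1=[x_2,x_1],\quad c_2=[x_3,x_1]v_1-[x_2,x_1]v_2,\quad c_3=[x_3,x_1]u_1-[x_2,x_1]u_2,\quad c_4=[x_3,x_2]u_1-[x_3,x_1]u_2+[x_2,x_1]u_3, \] \[ c_5=[x_3,x_1]u_3v_1-[x_3,x_1]u_1v_3+[x_3,x_2]u_1v_2-[x_3,x_2]u_2v_1-[x_2,x_1]u_3v_2+[x_2,x_1]u_2v_3 . \] Then: (i) $f_1,\dots,f_6$ lie in $K[U_3,V_3]^\delta$ and generate it as an algebra, and the ideal of all polynomial relations among them is generated by the single relation $f_6^2=f_1^2f_4+f_2^2f_3+2f_1f_2f_5$. The elements $f_1^{q_1}f_2^{q_2}f_3^{q_3}f_4^{q_4}f_5^{q_5}f_6^{e}$ with $q_1,\dots,q_5\ge 0$ and $e\in\{0,1\}$ form a $K$-basis of $K[U_3,V_3]^\delta$. (ii) The $K[U_3,V_3]^\delta$-module $(F_3')^\delta$ is generated by $c_1,\dots,c_5$, which satisfy the relations \[ c_1f_6=c_3f_2-c_2f_1,\qquad c_2f_6=c_4f_2^2-c_1(f_1f_4+f_2f_5),\qquad c_3f_6=c_4f_1f_2+c_1(f_1f_5+f_2f_3),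 \] \[ c_4f_6=c_2f_3+c_3f_5+c_5f_1,\qquad c_5f_2=c_2f_5+c_3f_4,\qquad c_5f_6=c_1(f_3f_4-f_5^2)+c_4(f_1f_4+f_2f_5), \] and these six are defining relations: the module of all $(s_1,\dots,s_5)\in(K[U_3,V_3]^\delta)^5$ with $\sum_j c_js_j=0$ is generated by the six coefficient vectors of these relations. The elements $c_jf_1^{m_1}f_2^{m_2}f_3^{m_3}f_4^{m_4}f_5^{m_5}$ with $1\le j\le 5$, $m_1,\dots,m_5\ge 0$, and $m_2=0$ if $j=5$, form a $K$-basis of $(F_3')^\delta$. (iii) The algebra $F_3^\delta$ is generated by the infinite set $\{x_1,\ x_2^2-(x_1x_3+x_3x_1)\}\cup\{c_jf_5^{p}\mid 1\le j\le 5,\ p\ge 0\}$. -/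

import Mathlib

noncomputable section

namespace FreeMetab

open MvPolynomial

/-! ### The free metabelian associative algebra `F_d` -/

/-- All consequences `[p,q][r,s] = 0` of the metabelian identity in the free algebra. -/
inductive Rel (K : Type*) [Field K] (d : ℕ) :
    FreeAlgebra K (Fin d) → FreeAlgebra K (Fin d) → Prop
  | metabelian (p q r s : FreeAlgebra K (Fin d)) :
      Rel K d ((p * q - q * p) * (r * s - s * r)) 0

/-- The free metabelian (unitary) associative algebra of rank `d`: the quotient of the free
associative algebra by all the identities `[p,q][r,s] = 0`. -/
def F (K : Type*) [Field K] (d : ℕ) : Type _ := RingQuot (Rel K d)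

instance instRing (K : Type*) [Field K] (d : ℕ) : Ring (F K d) :=
  inferInstanceAs (Ring (RingQuot (Rel K d)))

instance instAlgebra (K : Type*) [Field K] (d : ℕ) : Algebra K (F K d) :=
  inferInstanceAs (Algebra K (RingQuot (Rel K d)))

/-- The canonical projection from the free algebra. -/
def proj (K : Type*) [Field K] (d : ℕ) : FreeAlgebra K (Fin d) →ₐ[K] F K d :=
  RingQuot.mkAlgHom K (Rel K d)

theorem proj_surjective (K : Type*) [Field K] (d : ℕ) : Function.Surjective (proj K d) :=
  RingQuot.mkAlgHom_surjective K (Rel K d)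

/-- The free generators of `F_d`; the variable usually written `x_{i+1}` is `x K d i`. -/
def x (K : Type*) [Field K] (d : ℕ) (i : Fin d) : F K d :=
  proj K d (FreeAlgebra.ι K i)

/-- The algebra map from `F_d` to a metabelian algebra which sends `x_i` to `g i`. -/
def liftF {K : Type*} [Field K] {d : ℕ} {B : Type*} [Ring B] [Algebra K B] (g : Fin d → B)
    (h : ∀ p q r s : B, (p * q - q * p) * (r * s - s * r) = 0) : F K d →ₐ[K] B :=
  RingQuot.liftAlgHom K (s := Rel K d) ⟨FreeAlgebra.lift K g, by
    rintro _ _ ⟨p, q, r, s⟩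
    simp only [map_mul, map_sub, map_zero]
    exact h _ _ _ _⟩

theorem liftF_x {K : Type*} [Field K] {d : ℕ} {B : Type*} [Ring B] [Algebra K B] (g : Fin d → B)
    (h : ∀ p q r s : B, (p * q - q * p) * (r * s - s * r) = 0) (i : Fin d) :
    liftF g h (x K d i) = g i :=
  (RingQuot.liftAlgHom_mkAlgHom_apply K _ _ _).trans (FreeAlgebra.lift_ι_apply g i)

theorem hom_ext {K : Type*} [Field K] {d : ℕ} {B : Type*} [Ring B] [Algebra K B]
    {φ ψ : F K d →ₐ[K] B} (h : ∀ i, φ (x K d i) = ψ (x K d i)) : φ = ψ := by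
  have h1 : φ.comp (proj K d) = ψ.comp (proj K d) := by
    ext i
    exact h i
  ext w
  obtain ⟨w, rfl⟩ := proj_surjective K d w
  exact DFunLike.congr_fun h1 w

/-- The commutator ideal `F_d'`, the two-sided ideal generated by all commutators
(regarded as a `K`-subspace of `F_d`). -/
def commIdeal (K : Type*) [Field K] (d : ℕ) : Submodule K (F K d) :=
  (TwoSidedIdeal.asIdeal
    (TwoSidedIdeal.span {w : F K d | ∃ p q : F K d, w = p * q - q * p})).restrictScalars K

variable {K : Type*} [Field K] {d : ℕ}

theorem mem_commIdeal {w : F K d} : w ∈ commIdeal K d ↔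
    w ∈ TwoSidedIdeal.span {w : F K d | ∃ p q : F K d, w = p * q - q * p} := Iff.rfl

theorem comm_mem (p q : F K d) : p * q - q * p ∈ commIdeal K d :=
  mem_commIdeal.2 (TwoSidedIdeal.subset_span ⟨p, q, rfl⟩)

theorem commIdeal_mul_mem_left (a : F K d) {w : F K d} (hw : w ∈ commIdeal K d) :
    a * w ∈ commIdeal K d :=
  mem_commIdeal.2 (TwoSidedIdeal.mul_mem_left _ _ _ (mem_commIdeal.1 hw))

theorem commIdeal_mul_mem_right (a : F K d) {w : F K d} (hw : w ∈ commIdeal K d) :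
    w * a ∈ commIdeal K d :=
  mem_commIdeal.2 (TwoSidedIdeal.mul_mem_right _ _ _ (mem_commIdeal.1 hw))

theorem commIdeal_induction {P : F K d → Prop} (hc : ∀ p q : F K d, P (p * q - q * p))
    (h0 : P 0) (hadd : ∀ a b, a ∈ commIdeal K d → b ∈ commIdeal K d → P a → P b → P (a + b))
    (hneg : ∀ a, P a → P (-a))
    (hl : ∀ a b, b ∈ commIdeal K d → P b → P (a * b))
    (hr : ∀ a b, b ∈ commIdeal K d → P b → P (b * a))
    {w : F K d} (hw : w ∈ commIdeal K d) : P w := by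
  induction mem_commIdeal.1 hw using TwoSidedIdeal.span_induction with
  | mem w h => obtain ⟨p, q, rfl⟩ := h; exact hc p q
  | zero => exact h0
  | add a b ha hb iha ihb => exact hadd a b ha hb (iha ha) (ihb hb)
  | neg a ha ih => exact hneg a (ih ha)
  | left_absorb a b hb ih => exact hl a b hb (ih hb)
  | right_absorb a b hb ih => exact hr a b hb (ih hb)

theorem comm_mul_comm (p q r s : F K d) : (p * q - q * p) * (r * s - s * r) = 0 := by
  obtain ⟨p, rfl⟩ := proj_surjective K d p
  obtain ⟨q, rfl⟩ := proj_surjective K d q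
  obtain ⟨r, rfl⟩ := proj_surjective K d r
  obtain ⟨s, rfl⟩ := proj_surjective K d s
  have : proj K d ((p * q - q * p) * (r * s - s * r)) = proj K d 0 :=
    RingQuot.mkAlgHom_rel K (Rel.metabelian p q r s)
  simpa using this

theorem comm_mul_comm' (p q b r s : F K d) : (p * q - q * p) * b * (r * s - s * r) = 0 := by
  have h1 := comm_mul_comm p q (b * r) s
  have h2 := comm_mul_comm p q b s
  have e : (p * q - q * p) * b * (r * s - s * r) =
      (p * q - q * p) * (b * r * s - s * (b * r)) -
        (p * q - q * p) * (b * s - s * b) * r := by noncomm_ring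
  rw [e, h1, h2]; simp

theorem comm_mul_eq_zero (p q b : F K d) {w : F K d} (hw : w ∈ commIdeal K d) :
    (p * q - q * p) * b * w = 0 := by
  refine commIdeal_induction (P := fun w => ∀ b, (p * q - q * p) * b * w = 0)
    ?_ ?_ ?_ ?_ ?_ ?_ hw b
  · intro r s b; exact comm_mul_comm' p q b r s
  · simp
  · intro u v _ _ hu hv b; rw [mul_add, hu, hv, add_zero]
  · intro u hu b; rw [mul_neg, hu, neg_zero]
  · intro a u _ hu b; rw [← mul_assoc, mul_assoc _ b a]; exact hu _
  · intro a u _ hu b; rw [← mul_assoc, hu, zero_mul]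

theorem commIdeal_mul_eq_zero {z w : F K d} (hz : z ∈ commIdeal K d) (hw : w ∈ commIdeal K d) :
    z * w = 0 := by
  have key : ∀ b, z * b * w = 0 := by
    refine commIdeal_induction (P := fun z => ∀ b, z * b * w = 0) ?_ ?_ ?_ ?_ ?_ ?_ hz
    · intro p q b; exact comm_mul_eq_zero p q b hw
    · simp
    · intro u v _ _ hu hv b; rw [add_mul, add_mul, hu, hv, add_zero]
    · intro u hu b; rw [neg_mul, neg_mul, hu, neg_zero]
    · intro a u _ hu b; rw [mul_assoc a, mul_assoc a, hu, mul_zero]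
    · intro a u _ hu b; rw [mul_assoc u]; exact hu _
  simpa using key 1

/-- The commutator `[p,q]` as an element of `F_d'`. -/
def commutator (p q : F K d) : commIdeal K d := ⟨p * q - q * p, comm_mem p q⟩

/-! ### The action of `K[U_d,V_d]` on `F_d'` -/

/-- The polynomial algebra `K[U_d,V_d]`; the variables `u_i` and `v_i` are
`X (Sum.inl i)` and `X (Sum.inr i)`. -/
abbrev PolyUV (K : Type*) [Field K] (d : ℕ) : Type _ := MvPolynomial (Fin d ⊕ Fin d) K

/-- The operator `w ↦ x_i w` on `F_d'`. -/
def opU (i : Fin d) : Module.End K (commIdeal K d) where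
  toFun w := ⟨x K d i * w, commIdeal_mul_mem_left _ w.2⟩
  map_add' a b := by ext; simp [mul_add]
  map_smul' c a := by ext; simp

/-- The operator `w ↦ [w, x_i] = w x_i - x_i w` on `F_d'`. -/
def opV (i : Fin d) : Module.End K (commIdeal K d) where
  toFun w := ⟨w * x K d i - x K d i * w,
    (commIdeal K d).sub_mem (commIdeal_mul_mem_right _ w.2) (commIdeal_mul_mem_left _ w.2)⟩
  map_add' a b := by ext; simp [mul_add, add_mul]; abel
  map_smul' c a := by ext; simp [smul_sub]

/-- `u_i` acts as `w ↦ x_i w`, and `v_i` acts as `w ↦ [w, x_i]`. -/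
def op : Fin d ⊕ Fin d → Module.End K (commIdeal K d) := Sum.elim opU opV

theorem op_commute (s t : Fin d ⊕ Fin d) :
    (op s : Module.End K (commIdeal K d)) * op t = op t * op s := by
  have hl : ∀ (i j : Fin d) (w : commIdeal K d),
      (x K d i * x K d j - x K d j * x K d i) * (w : F K d) = 0 :=
    fun i j w => commIdeal_mul_eq_zero (comm_mem _ _) w.2
  have hr : ∀ (i j : Fin d) (w : commIdeal K d),
      (w : F K d) * (x K d i * x K d j - x K d j * x K d i) = 0 :=
    fun i j w => commIdeal_mul_eq_zero w.2 (comm_mem _ _)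
  rcases s with i | i <;> rcases t with j | j <;> ext w <;>
    simp only [op, Sum.elim_inl, Sum.elim_inr, opU, opV, Module.End.mul_apply,
      LinearMap.coe_mk, AddHom.coe_mk] <;> rw [← sub_eq_zero]
  · rw [← hl i j w]; noncomm_ring
  · rw [← neg_eq_zero, ← hl i j w]; noncomm_ring
  · rw [← hl j i w]; noncomm_ring
  · have e : ∀ a b w : F K d, (w * b - b * w) * a - a * (w * b - b * w) -
        ((w * a - a * w) * b - b * (w * a - a * w)) =
        w * (b * a - a * b) + (a * b - b * a) * w := by intro a b w; noncomm_ring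
    rw [e, hl, hr, add_zero]

section commAeval

open scoped IsMulCommutative

/-- The evaluation of polynomials at a family of pairwise commuting elements. -/
def commAeval {σ A : Type*} [Ring A] [Algebra K A] (g : σ → A)
    (hg : ∀ s t, g s * g t = g t * g s) : MvPolynomial σ K →ₐ[K] A :=
  haveI : IsMulCommutative (Algebra.adjoin K (Set.range g)) :=
    Algebra.isMulCommutative_adjoin K (by
      rintro _ ⟨s, rfl⟩ _ ⟨t, rfl⟩
      exact hg s t)
  (Algebra.adjoin K (Set.range g)).val.comp
    (aeval (fun s => (⟨g s, Algebra.subset_adjoin ⟨s, rfl⟩⟩ : Algebra.adjoin K (Set.range g))))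

theorem commAeval_X {σ A : Type*} [Ring A] [Algebra K A] (g : σ → A)
    (hg : ∀ s t, g s * g t = g t * g s) (s : σ) :
    commAeval (K := K) g hg (X s) = g s := by
  simp [commAeval]

end commAeval

/-- The representation of `K[U_d,V_d]` on `F_d'` sending the variables to the operators `op`. -/
def act (K : Type*) [Field K] (d : ℕ) : PolyUV K d →ₐ[K] Module.End K (commIdeal K d) :=
  commAeval op op_commute

theorem act_X (s : Fin d ⊕ Fin d) : act K d (X s) = op s :=
  commAeval_X _ _ _

/-- The `K[U_d,V_d]`-module structure of `F_d'`. -/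
instance moduleUV : Module (PolyUV K d) (commIdeal K d) :=
  Module.compHom (commIdeal K d) (act K d).toRingHom

theorem smul_def (p : PolyUV K d) (w : commIdeal K d) : p • w = act K d p w := rfl

theorem u_smul (i : Fin d) (w : commIdeal K d) :
    ((X (Sum.inl i) : PolyUV K d) • w : commIdeal K d) = x K d i * (w : F K d) := by
  rw [smul_def, act_X]; rfl

theorem v_smul (i : Fin d) (w : commIdeal K d) :
    ((X (Sum.inr i) : PolyUV K d) • w : commIdeal K d) =
      (w : F K d) * x K d i - x K d i * (w : F K d) := by
  rw [smul_def, act_X]; rfl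

instance towerUV : IsScalarTower K (PolyUV K d) (commIdeal K d) where
  smul_assoc c p w := by simp [smul_def]

/-! ### The derivation determined by a matrix -/

theorem dual_metabelian (p q r s : DualNumber (F K d)) :
    (p * q - q * p) * (r * s - s * r) = 0 := by
  have h : ∀ a b : DualNumber (F K d), (a * b - b * a).snd ∈ commIdeal K d := by
    intro a b
    have e : (a * b - b * a).snd = (a.fst * b.snd - b.snd * a.fst) +
        (a.snd * b.fst - b.fst * a.snd) := by
      simp [TrivSqZeroExt.snd_mul]; abel
    rw [e]
    exact (commIdeal K d).add_mem (comm_mem _ _) (comm_mem _ _)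
  ext
  · simp only [TrivSqZeroExt.fst_mul, TrivSqZeroExt.fst_sub, TrivSqZeroExt.fst_zero]
    exact comm_mul_comm _ _ _ _
  · have e : ∀ a b : DualNumber (F K d), (a * b).snd = a.fst * b.snd + a.snd * b.fst := by
      intro a b; simp [TrivSqZeroExt.snd_mul]
    rw [e, commIdeal_mul_eq_zero (by simpa using comm_mem _ _) (h r s),
      commIdeal_mul_eq_zero (h p q) (by simpa using comm_mem _ _)]
    simp

/-- The algebra map `w ↦ w + ε δ(w)` from `F_d` to the dual numbers over `F_d`, where
`δ(x_j) = ∑ i, α i j • x_i`. -/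
def derHom (α : Matrix (Fin d) (Fin d) K) : F K d →ₐ[K] DualNumber (F K d) :=
  liftF (fun j => TrivSqZeroExt.inl (x K d j) + TrivSqZeroExt.inr (∑ i, α i j • x K d i))
    dual_metabelian

/-- The derivation `δ` of `F_d` with `δ(x_j) = ∑ i, α i j • x_i`. -/
def der (α : Matrix (Fin d) (Fin d) K) : F K d →ₗ[K] F K d :=
  (TrivSqZeroExt.sndHom (F K d) (F K d)).restrictScalars K ∘ₗ (derHom α).toLinearMap

theorem der_x (α : Matrix (Fin d) (Fin d) K) (j : Fin d) :
    der α (x K d j) = ∑ i, α i j • x K d i := by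
  have h : der α (x K d j) = (derHom α (x K d j)).snd := rfl
  rw [h, derHom, liftF_x]
  simp

theorem derHom_fst (α : Matrix (Fin d) (Fin d) K) (w : F K d) : (derHom α w).fst = w := by
  have : (TrivSqZeroExt.fstHom K (F K d) (F K d)).comp (derHom α) = AlgHom.id K (F K d) := by
    apply hom_ext
    intro j
    rw [AlgHom.comp_apply, derHom, liftF_x]
    simp
  exact DFunLike.congr_fun this w

theorem der_mul (α : Matrix (Fin d) (Fin d) K) (a b : F K d) :
    der α (a * b) = der α a * b + a * der α b := by
  have e : ∀ a : F K d, der α a = (derHom α a).snd := fun _ => rfl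
  simp only [e, map_mul, TrivSqZeroExt.snd_mul, derHom_fst]
  simp [add_comm]

theorem der_mem (α : Matrix (Fin d) (Fin d) K) {w : F K d} (hw : w ∈ commIdeal K d) :
    der α w ∈ commIdeal K d := by
  refine commIdeal_induction (P := fun w => der α w ∈ commIdeal K d) ?_ ?_ ?_ ?_ ?_ ?_ hw
  · intro p q
    have e : der α (p * q - q * p) =
        (der α p * q - q * der α p) + (p * der α q - der α q * p) := by
      rw [map_sub, der_mul, der_mul]; abel
    rw [e]
    exact (commIdeal K d).add_mem (comm_mem _ _) (comm_mem _ _)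
  · simp
  · intro a b _ _ ha hb; rw [map_add]; exact (commIdeal K d).add_mem ha hb
  · intro a ha; rw [map_neg]; exact (commIdeal K d).neg_mem ha
  · intro a b hb h; rw [der_mul]
    exact (commIdeal K d).add_mem (commIdeal_mul_mem_left _ hb) (commIdeal_mul_mem_left _ h)
  · intro a b hb h; rw [der_mul]
    exact (commIdeal K d).add_mem (commIdeal_mul_mem_right _ h) (commIdeal_mul_mem_right _ hb)

/-- The restriction of `δ` to `F_d'`. -/
def derComm (α : Matrix (Fin d) (Fin d) K) : commIdeal K d →ₗ[K] commIdeal K d :=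
  (der α).restrict fun _ hw => der_mem α hw

/-- The derivation `δ` of `K[U_d,V_d]`, acting on `U_d` and on `V_d` in the same way as on `X_d`. -/
def polyDer (α : Matrix (Fin d) (Fin d) K) : Derivation K (PolyUV K d) (PolyUV K d) :=
  mkDerivation K (Sum.elim (fun j => ∑ i, α i j • X (Sum.inl i))
    (fun j => ∑ i, α i j • X (Sum.inr i)))

theorem derComm_smul (α : Matrix (Fin d) (Fin d) K) (p : PolyUV K d) (w : commIdeal K d) :
    derComm α (p • w) = polyDer α p • w + p • derComm α w := by
  induction p using MvPolynomial.induction_on generalizing w with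
  | C a =>
    have h : ∀ z : commIdeal K d, (C a : PolyUV K d) • z = a • z := fun z => by
      rw [← algebraMap_eq, algebraMap_smul]
    rw [h, h, map_smul, ← algebraMap_eq, Derivation.map_algebraMap, zero_smul, zero_add]
  | add p q hp hq => rw [add_smul, map_add, hp, hq, map_add, add_smul, add_smul]; abel
  | mul_X p s h =>
    have hX : derComm α ((X s : PolyUV K d) • w) =
        polyDer α (X s) • w + (X s : PolyUV K d) • derComm α w := by
      ext
      rcases s with j | j
      · simp only [polyDer, mkDerivation_X, Sum.elim_inl, Finset.sum_smul, smul_assoc,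
          derComm, LinearMap.coe_restrict_apply, Submodule.coe_add, Submodule.coe_sum,
          Submodule.coe_smul, u_smul, der_mul, der_x, Finset.sum_mul, smul_mul_assoc]
      · simp only [polyDer, mkDerivation_X, Sum.elim_inr, Finset.sum_smul, smul_assoc,
          derComm, LinearMap.coe_restrict_apply, Submodule.coe_add, Submodule.coe_sum,
          Submodule.coe_smul, v_smul, der_mul, der_x, Finset.sum_mul, smul_mul_assoc,
          map_sub, Finset.mul_sum, mul_smul_comm, smul_sub, Finset.sum_sub_distrib]
        abel
    rw [mul_smul, h, hX, Derivation.leibniz, add_smul, smul_eq_mul, smul_eq_mul, mul_smul,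
      mul_comm (X s), mul_smul, smul_add, mul_smul]
    simp only [← mul_smul, mul_comm]
    abel

/-! ### Constants -/

/-- The algebra of constants `F_d^δ`. -/
def algConst (α : Matrix (Fin d) (Fin d) K) : Subalgebra K (F K d) where
  carrier := {w | der α w = 0}
  mul_mem' {a b} ha hb := by
    simp only [Set.mem_ofPred_eq] at *
    rw [der_mul, ha, hb, zero_mul, mul_zero, add_zero]
  add_mem' {a b} ha hb := by
    simp only [Set.mem_ofPred_eq] at *
    rw [map_add, ha, hb, add_zero]
  algebraMap_mem' r := by
    have h := der_mul α (1 : F K d) 1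
    have h1 : der α (1 : F K d) = 0 := by simpa using h
    simp [Algebra.algebraMap_eq_smul_one, h1]

/-- The algebra of constants `K[U_d,V_d]^δ`. -/
def polyConst (α : Matrix (Fin d) (Fin d) K) : Subalgebra K (PolyUV K d) where
  carrier := {p | polyDer α p = 0}
  mul_mem' {a b} ha hb := by
    simp only [Set.mem_ofPred_eq] at *
    simp [Derivation.leibniz, ha, hb]
  add_mem' {a b} ha hb := by
    simp only [Set.mem_ofPred_eq] at *
    rw [map_add, ha, hb, add_zero]
  algebraMap_mem' r := (polyDer α).map_algebraMap r

theorem mem_polyConst (α : Matrix (Fin d) (Fin d) K) {p : PolyUV K d} :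
    p ∈ polyConst α ↔ polyDer α p = 0 := Iff.rfl

/-- The `K[U_d,V_d]^δ`-module of constants `(F_d')^δ`. -/
def commConst (α : Matrix (Fin d) (Fin d) K) : Submodule (polyConst α) (commIdeal K d) where
  carrier := {w | der α (w : F K d) = 0}
  add_mem' {a b} ha hb := by
    simp only [Set.mem_ofPred_eq] at *
    rw [Submodule.coe_add, map_add, ha, hb, add_zero]
  zero_mem' := by simp
  smul_mem' p w hw := by
    have h : derComm α w = 0 := Subtype.ext hw
    have h2 := derComm_smul α (p : PolyUV K d) w
    rw [h, (mem_polyConst α).1 p.2, zero_smul, smul_zero, add_zero] at h2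
    exact congrArg Subtype.val h2

/-! ### One Jordan cell of size 3 -/

/-- The single Jordan cell: `δ(x_1) = 0`, `δ(x_2) = x_1`, `δ(x_3) = x_2`. -/
def cell3 (K : Type*) [Field K] : Matrix (Fin 3) (Fin 3) K :=
  !![0, 1, 0; 0, 0, 1; 0, 0, 0]

theorem der_x₁ (K : Type*) [Field K] : der (cell3 K) (x K 3 0) = 0 := by
  simp [der_x, cell3, Fin.sum_univ_three]
theorem der_x₂ (K : Type*) [Field K] : der (cell3 K) (x K 3 1) = x K 3 0 := by
  simp [der_x, cell3, Fin.sum_univ_three]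
theorem der_x₃ (K : Type*) [Field K] : der (cell3 K) (x K 3 2) = x K 3 1 := by
  simp [der_x, cell3, Fin.sum_univ_three]

section generators

variable (K : Type*) [Field K]

/-- The variable `u_1`. -/
def u₁ : PolyUV K 3 := X (Sum.inl 0)
/-- The variable `u_2`. -/
def u₂ : PolyUV K 3 := X (Sum.inl 1)
/-- The variable `u_3`. -/
def u₃ : PolyUV K 3 := X (Sum.inl 2)
/-- The variable `v_1`. -/
def v₁ : PolyUV K 3 := X (Sum.inr 0)
/-- The variable `v_2`. -/
def v₂ : PolyUV K 3 := X (Sum.inr 1)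
/-- The variable `v_3`. -/
def v₃ : PolyUV K 3 := X (Sum.inr 2)

theorem polyDer_u₁ : polyDer (cell3 K) (u₁ K) = 0 := by
  simp [polyDer, cell3, u₁, Fin.sum_univ_three]
theorem polyDer_u₂ : polyDer (cell3 K) (u₂ K) = u₁ K := by
  simp [polyDer, cell3, u₁, u₂, Fin.sum_univ_three]
theorem polyDer_u₃ : polyDer (cell3 K) (u₃ K) = u₂ K := by
  simp [polyDer, cell3, u₂, u₃, Fin.sum_univ_three]
theorem polyDer_v₁ : polyDer (cell3 K) (v₁ K) = 0 := by
  simp [polyDer, cell3, v₁, Fin.sum_univ_three]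
theorem polyDer_v₂ : polyDer (cell3 K) (v₂ K) = v₁ K := by
  simp [polyDer, cell3, v₁, v₂, Fin.sum_univ_three]
theorem polyDer_v₃ : polyDer (cell3 K) (v₃ K) = v₂ K := by
  simp [polyDer, cell3, v₂, v₃, Fin.sum_univ_three]

/-- The polynomials `f_1, …, f_6`, as elements of `K[U_3,V_3]^δ`. -/
def f₁ : polyConst (cell3 K) := ⟨u₁ K, polyDer_u₁ K⟩
def f₂ : polyConst (cell3 K) := ⟨v₁ K, polyDer_v₁ K⟩
def f₃ : polyConst (cell3 K) := ⟨u₂ K ^ 2 - 2 * u₁ K * u₃ K, by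
  simp only [mem_polyConst, pow_two, two_mul, add_mul, map_sub, map_add, Derivation.leibniz,
    polyDer_u₁, polyDer_u₂, polyDer_u₃, smul_eq_mul]
  ring⟩
def f₄ : polyConst (cell3 K) := ⟨v₂ K ^ 2 - 2 * v₁ K * v₃ K, by
  simp only [mem_polyConst, pow_two, two_mul, add_mul, map_sub, map_add, Derivation.leibniz,
    polyDer_v₁, polyDer_v₂, polyDer_v₃, smul_eq_mul]
  ring⟩
def f₅ : polyConst (cell3 K) :=
  ⟨u₁ K * v₃ K - u₂ K * v₂ K + u₃ K * v₁ K, by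
  simp only [mem_polyConst, map_sub, map_add, Derivation.leibniz, polyDer_u₁, polyDer_u₂,
    polyDer_u₃, polyDer_v₁, polyDer_v₂, polyDer_v₃, smul_eq_mul]
  ring⟩
def f₆ : polyConst (cell3 K) := ⟨u₁ K * v₂ K - u₂ K * v₁ K, by
  simp only [mem_polyConst, map_sub, Derivation.leibniz, polyDer_u₁, polyDer_u₂,
    polyDer_v₁, polyDer_v₂, smul_eq_mul]
  ring⟩

/-- The commutators `[x_2,x_1]`, `[x_3,x_1]`, `[x_3,x_2]` in `F_3'`. -/
def x₂₁ : commIdeal K 3 := commutator (x K 3 1) (x K 3 0)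
def x₃₁ : commIdeal K 3 := commutator (x K 3 2) (x K 3 0)
def x₃₂ : commIdeal K 3 := commutator (x K 3 2) (x K 3 1)

/-- The elements `c_1, …, c_5` of `F_3'`. -/
def c₁ : commIdeal K 3 := x₂₁ K
def c₂ : commIdeal K 3 := v₁ K • x₃₁ K - v₂ K • x₂₁ K
def c₃ : commIdeal K 3 := u₁ K • x₃₁ K - u₂ K • x₂₁ K
def c₄ : commIdeal K 3 := u₁ K • x₃₂ K - u₂ K • x₃₁ K + u₃ K • x₂₁ K
def c₅ : commIdeal K 3 :=
  (u₃ K * v₁ K) • x₃₁ K - (u₁ K * v₃ K) • x₃₁ K + (u₁ K * v₂ K) • x₃₂ K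
    - (u₂ K * v₁ K) • x₃₂ K - (u₃ K * v₂ K) • x₂₁ K + (u₂ K * v₃ K) • x₂₁ K

/-- The family `f_1, …, f_6`. -/
def f : Fin 6 → polyConst (cell3 K) := ![f₁ K, f₂ K, f₃ K, f₄ K, f₅ K, f₆ K]

/-- The family `c_1, …, c_5`. -/
def c : Fin 5 → commIdeal K 3 := ![c₁ K, c₂ K, c₃ K, c₄ K, c₅ K]

/-- The monomial `f_1^{m_1} ⋯ f_5^{m_5}`. -/
def fMonomial (m : Fin 5 → ℕ) : polyConst (cell3 K) := ∏ i : Fin 5, f K i.castSucc ^ m i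

/-- The coefficient vectors `(s_1, …, s_5)` of the six relations `∑ j, c_j s_j = 0`. -/
def relation : Fin 6 → Fin 5 → polyConst (cell3 K) :=
  ![![f₆ K, f₁ K, -f₂ K, 0, 0],
    ![f₁ K * f₄ K + f₂ K * f₅ K, f₆ K, 0, -f₂ K ^ 2, 0],
    ![-(f₁ K * f₅ K + f₂ K * f₃ K), 0, f₆ K, -(f₁ K * f₂ K), 0],
    ![0, -f₃ K, -f₅ K, f₆ K, -f₁ K],
    ![0, -f₅ K, -f₄ K, 0, f₂ K],
    ![-(f₃ K * f₄ K - f₅ K ^ 2), 0, 0, -(f₁ K * f₄ K + f₂ K * f₅ K), f₆ K]]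

/-- The generating set of the algebra `F_3^δ`. -/
def algGenerators : Set (F K 3) :=
  {x K 3 0, x K 3 1 ^ 2 - (x K 3 0 * x K 3 2 + x K 3 2 * x K 3 0)} ∪
    {w | ∃ (j : Fin 5) (p : ℕ), w = ((f₅ K ^ p • c K j : commIdeal K 3) : F K 3)}

end generators

end FreeMetab

end

/-! Both modules of constants are computed by one localization argument. Since `δ u₂ = u₁` and `u₁`
is a constant, `u₂ / u₁` is a slice. After multiplication by a power of `u₁`, every element becomes
a polynomial in `u₂` whose coefficients are polynomials in the `f_i` (respectively combinations of
the `c_j` over these). In characteristic zero such a polynomial is a constant only if it equals its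
term of degree zero. So a constant `w` satisfies `u₁ ^ n • w ∈ M`, where `M` is the proposed module
of constants, and it remains to show that `M` is saturated: a constant `w` with `u₁ • w ∈ M` lies in
`M` (`mem_of_mem_sliceSpan`).

Saturation and linear independence have the same source. The proposed bases consist of the products
`f₁ ^ n • b` with `b` free of `f₁`. The specialization `u₁ = v₂ = 0` kills multiples of `f₁` and
turns the elements `b` into scalar multiples of monomials, or into pairs that can be separated by
components (`linearIndependent_polySpecialize`, `linearIndependent_commSpecialize`). Elements of
`F_3'` are made accessible to this by two representations by upper triangular matrices, which are
jointly faithful on `F_3'` (`eq_zero_of_corner`).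

The presentations follow by rewriting. Modulo the stated relations everything reduces to a
combination of normal monomials; the images of these are independent, so there are no further
relations (`ker_le_of_linearIndependent`).

For the algebra `F_3^δ`, constants are first compared modulo `F_3'`. There setting `V = 0` leaves
only `u₁` and `f₃`, which lift to `x_1` and the quadric. The difference is a constant in `F_3'`. On
`F_3'`, multiplication by `x_1` and by the quadric on either side realizes `f₁`, `f₂`, `f₃` and `f₄
- 2 f₅`, so `f₄` is available once all powers of `f₅` are supplied by the generators. -/

noncomputable section

namespace FreeMetab

open MvPolynomial

/-! ### Linear algebra: independence and saturation along an injective operator -/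

section LinearAlgebra

variable {K N N' I : Type*} [Field K] [AddCommGroup N] [Module K N] [AddCommGroup N'] [Module K N']

theorem linearIndependent_congr {b b' : I → N} (h : LinearIndependent K b)
    (e : ∀ i, b' i = b i) : LinearIndependent K b' := by
  rwa [funext e]

/-- In a vanishing combination, `q` sees only the terms with exponent zero, so their coefficients
vanish; then one factor `u` is cancelled and the argument repeats. -/
theorem linearIndependent_pow_apply {u : N →ₗ[K] N} (hu : Function.Injective u) {q : N →ₗ[K] N'}
    (hqu : ∀ w, q (u w) = 0) {b : I → N} (hb : LinearIndependent K fun i => q (b i)) :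
    LinearIndependent K fun a : ℕ × I => (u ^ a.1) (b a.2) := by
  have key : ∀ (d : ℕ) (l : ℕ → I →₀ K),
      ∑ n ∈ Finset.range d, (u ^ n) (Finsupp.linearCombination K b (l n)) = 0 →
      ∀ n < d, l n = 0 := by
    intro d
    induction d with
    | zero => intro l _ n hn; omega
    | succ d ih =>
      intro l hl
      rw [Finset.sum_range_succ'] at hl
      have e : ∑ n ∈ Finset.range d, (u ^ (n + 1)) (Finsupp.linearCombination K b (l (n + 1))) =
          u (∑ n ∈ Finset.range d, (u ^ n) (Finsupp.linearCombination K b (l (n + 1)))) := by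
        simp [map_sum, pow_succ']
      rw [e, pow_zero, Module.End.one_apply] at hl
      have h0 : l 0 = 0 := by
        refine linearIndependent_iff.1 hb _ ?_
        have := congrArg q hl
        rw [map_add, hqu, zero_add, map_zero, Finsupp.apply_linearCombination] at this
        exact this
      rw [h0, map_zero, add_zero] at hl
      have h1 := ih (fun n => l (n + 1)) (hu (by rw [hl, map_zero]))
      intro n hn
      rcases n with _ | n
      · exact h0
      · exact h1 n (by omega)
  rw [linearIndependent_iff]
  intro l hl
  obtain ⟨d, hd⟩ : ∃ d, l.curry.support ⊆ Finset.range d := by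
    obtain ⟨d, hd⟩ := l.curry.support.bddAbove
    exact ⟨d + 1, fun n hn => Finset.mem_range.2 (Nat.lt_succ_of_le (hd hn))⟩
  have hs : ∑ n ∈ Finset.range d, (u ^ n) (Finsupp.linearCombination K b (l.curry n)) = 0 := by
    rw [← hl, Finsupp.linearCombination_apply,
      ← Finsupp.sum_curry_index l (fun n i a => a • (u ^ n) (b i)),
      Finsupp.sum_of_support_subset _ hd _ (by simp)]
    refine Finset.sum_congr rfl fun n _ => ?_
    rw [Finsupp.linearCombination_apply, map_finsuppSum]
    simp
  have h := key d _ hs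
  ext ⟨n, i⟩
  have : l.curry n = 0 := by
    by_cases hn : n < d
    · exact h n hn
    · by_contra h0
      exact hn (Finset.mem_range.1 (hd (Finsupp.mem_support_iff.2 h0)))
  simpa using DFunLike.congr_fun this i

/-- This gives saturation. An element of the span is a combination of the `b i` plus `u v` with `v`
in the span; if it is itself `u w`, then `q` forces the combination to vanish, and injectivity gives
`w = v`. -/
theorem mem_span_pow_apply_of_apply_mem {u : N →ₗ[K] N} (hu : Function.Injective u)
    {q : N →ₗ[K] N'} (hqu : ∀ w, q (u w) = 0) {b : I → N}
    (hb : LinearIndependent K fun i => q (b i)) {w : N}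
    (hw : u w ∈ Submodule.span K (Set.range fun a : ℕ × I => (u ^ a.1) (b a.2))) :
    w ∈ Submodule.span K (Set.range fun a : ℕ × I => (u ^ a.1) (b a.2)) := by
  set V := Submodule.span K (Set.range fun a : ℕ × I => (u ^ a.1) (b a.2)) with hV
  have key : ∀ z ∈ V, ∃ l : I →₀ K, ∃ v ∈ V, z = Finsupp.linearCombination K b l + u v := by
    intro z hz
    induction hz using Submodule.span_induction with
    | mem z hz =>
      obtain ⟨⟨n, i⟩, rfl⟩ := hz
      rcases n with _ | n
      · exact ⟨Finsupp.single i 1, 0, V.zero_mem, by simp⟩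
      · exact ⟨0, (u ^ n) (b i), Submodule.subset_span ⟨(n, i), rfl⟩, by simp [pow_succ']⟩
    | zero => exact ⟨0, 0, V.zero_mem, by simp⟩
    | add x y _ _ hx hy =>
      obtain ⟨l, v, hv, rfl⟩ := hx
      obtain ⟨l', v', hv', rfl⟩ := hy
      exact ⟨l + l', v + v', V.add_mem hv hv', by rw [map_add, map_add]; abel⟩
    | smul a x _ hx =>
      obtain ⟨l, v, hv, rfl⟩ := hx
      exact ⟨a • l, a • v, V.smul_mem a hv, by rw [map_smul, map_smul, smul_add]⟩
  obtain ⟨l, v, hv, e⟩ := key _ hw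
  have h0 : l = 0 := by
    refine linearIndependent_iff.1 hb _ ?_
    have := congrArg q e
    rw [map_add, hqu, hqu, add_zero, Finsupp.apply_linearCombination] at this
    exact this.symm
  rw [h0, map_zero, zero_add] at e
  rwa [hu e]

/-- Turns a rewriting procedure into a presentation: normal forms span modulo the known relations
`J`, and their images are independent, so a relation has normal form zero. -/
theorem ker_le_of_linearIndependent {φ : N →ₗ[K] N'} {m : I → N} {J : Submodule K N}
    (hm : LinearIndependent K fun i => φ (m i)) (hJ : J ≤ LinearMap.ker φ)
    (htop : Submodule.span K (Set.range m) ⊔ J = ⊤) : LinearMap.ker φ ≤ J := by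
  intro w hw
  obtain ⟨y, hy, z, hz, rfl⟩ := Submodule.mem_sup.1 (htop ▸ Submodule.mem_top : w ∈ _)
  obtain ⟨l, rfl⟩ := (Finsupp.mem_span_range_iff_exists_finsupp).1 hy
  have : l = 0 := by
    refine linearIndependent_iff.1 hm _ ?_
    rw [LinearMap.mem_ker, map_add, LinearMap.mem_ker.1 (hJ hz), add_zero, map_finsuppSum] at hw
    simpa [Finsupp.linearCombination_apply] using hw
  simpa [this] using hz

theorem linearIndependent_of_block {N'' : Type*} [AddCommGroup N''] [Module K N''] {b : I → N}
    (p : I → Prop) (q : N →ₗ[K] N') (r : N →ₗ[K] N'') (hq0 : ∀ i, ¬ p i → q (b i) = 0)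
    (hq : LinearIndependent K fun i : {i // p i} => q (b i))
    (hr : LinearIndependent K fun i : {i // ¬ p i} => r (b i)) : LinearIndependent K b := by
  classical
  rw [linearIndependent_iff']
  intro s g hg
  have h1 : ∀ i ∈ s, p i → g i = 0 := by
    have h := congrArg q hg
    rw [map_sum, map_zero, ← Finset.sum_filter_of_ne (p := p), ← Finset.sum_subtype_eq_sum_filter] at h
    · simp only [map_smul] at h
      intro i hi hp
      exact linearIndependent_iff'.1 hq _ (fun i => g i) h ⟨i, hp⟩ (by simpa using hi)
    · intro i _ hi
      by_contra hp
      exact hi (by rw [map_smul, hq0 i hp, smul_zero])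
  have h2 : ∀ i ∈ s, ¬ p i → g i = 0 := by
    have h := congrArg r hg
    rw [map_sum, map_zero, ← Finset.sum_filter_of_ne (p := fun i => ¬ p i),
      ← Finset.sum_subtype_eq_sum_filter] at h
    · simp only [map_smul] at h
      intro i hi hp
      exact linearIndependent_iff'.1 hr _ (fun i => g i) h ⟨i, hp⟩ (by simpa using hi)
    · intro i his hi hp
      exact hi (by rw [h1 i his hp, zero_smul, map_zero])
  intro i hi
  by_cases hp : p i
  · exact h1 i hi hp
  · exact h2 i hi hp

end LinearAlgebra

/-! ### Constants of a derivation with a local slice -/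

section Slice

variable {K R N : Type*} [Field K] [CommRing R] [Algebra K R] [AddCommGroup N]
  [Module K N] [Module R N] [IsScalarTower K R N]

/-- The derivative is a polynomial in `s` of smaller degree whose coefficients `(k + 1) • u • a (k +
1)` are again constants. It vanishes, hence so does its own derivative, and induction kills its
higher coefficients; what is left is its constant term. Characteristic zero and `hu` cancel `k + 1`
and `u`. -/
theorem slice_coeff_eq_zero [CharZero K] {D : N →+ N} {δ : Derivation K R R}
    (hD : ∀ (p : R) (w : N), D (p • w) = δ p • w + p • D w) {s u : R} (hs : δ s = u)
    (hu : ∀ w : N, u • w = 0 → w = 0) {m : ℕ} : ∀ {a : ℕ → N}, (∀ k, D (a k) = 0) →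
    D (∑ k ∈ Finset.range (m + 1), s ^ k • a k) = 0 → δ u = 0 → ∀ k < m, a (k + 1) = 0 := by
  induction m with
  | zero => intro a _ _ _ k hk; omega
  | succ m ih =>
    intro a ha h hδ
    have hterm : ∀ k, D (s ^ (k + 1) • a (k + 1)) = s ^ k • ((k + 1 : K) • u • a (k + 1)) := by
      intro k
      rw [hD, ha, smul_zero, add_zero, Derivation.leibniz_pow, hs, ← Nat.cast_smul_eq_nsmul K,
        smul_assoc, smul_comm (s ^ k)]
      simp [mul_smul]
    have hE : D (∑ k ∈ Finset.range (m + 1 + 1), s ^ k • a k) =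
        ∑ k ∈ Finset.range (m + 1), s ^ k • ((k + 1 : K) • u • a (k + 1)) := by
      rw [Finset.sum_range_succ', map_add, map_sum, pow_zero, one_smul, ha, add_zero]
      exact Finset.sum_congr rfl fun k _ => hterm k
    have hc : ∀ (r : K) (w : N), D (r • w) = r • D w := fun r w => by
      rw [← algebraMap_smul R r w, hD, Derivation.map_algebraMap, zero_smul, zero_add,
        algebraMap_smul]
    have hcancel : ∀ k : ℕ, (k + 1 : K) • u • a (k + 1) = 0 → a (k + 1) = 0 := fun k hk =>
      hu _ ((smul_eq_zero.1 hk).resolve_left (by exact_mod_cast Nat.succ_ne_zero k))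
    rw [hE] at h
    have h1 := ih (a := fun k => (k + 1 : K) • u • a (k + 1))
      (fun k => by rw [hc, hD, hδ, ha, zero_smul, smul_zero, add_zero, smul_zero])
      (by rw [h, map_zero]) hδ
    have h2 : ∀ k < m, a (k + 2) = 0 := fun k hk => by
      have := h1 k hk
      exact hcancel (k + 1) this
    intro k hk
    rcases k with _ | k
    · rw [Finset.sum_range_succ', Finset.sum_eq_zero, zero_add, pow_zero, one_smul] at h
      · exact hcancel 0 h
      · intro k hk
        rw [h2 k (Finset.mem_range.1 hk)]; simp
    · exact h2 k (by omega)

variable (K) in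
/-- The polynomials in `s` with coefficients in `M`. -/
def polySpan (s : R) (M : Submodule K N) : Submodule K N :=
  Submodule.span K {z | ∃ k : ℕ, ∃ a ∈ M, z = s ^ k • a}

theorem smul_mem_polySpan_of_forall {s r : R} {M : Submodule K N} (hr : ∀ w ∈ M, r • w ∈ M) {w : N}
    (hw : w ∈ polySpan K s M) : r • w ∈ polySpan K s M := by
  induction hw using Submodule.span_induction with
  | mem w hw =>
    obtain ⟨k, a, ha, rfl⟩ := hw
    exact Submodule.subset_span ⟨k, r • a, hr a ha, smul_comm _ _ _⟩
  | zero => rw [smul_zero]; exact Submodule.zero_mem _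
  | add x y _ _ hx hy => rw [smul_add]; exact Submodule.add_mem _ hx hy
  | smul a x _ hx => rw [smul_comm]; exact Submodule.smul_mem _ _ hx

theorem self_smul_mem_polySpan {s : R} {M : Submodule K N} {w : N}
    (hw : w ∈ polySpan K s M) : s • w ∈ polySpan K s M := by
  induction hw using Submodule.span_induction with
  | mem w hw =>
    obtain ⟨k, a, ha, rfl⟩ := hw
    exact Submodule.subset_span ⟨k + 1, a, ha, by rw [pow_succ', mul_smul]⟩
  | zero => rw [smul_zero]; exact Submodule.zero_mem _
  | add x y _ _ hx hy => rw [smul_add]; exact Submodule.add_mem _ hx hy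
  | smul a x _ hx => rw [smul_comm]; exact Submodule.smul_mem _ _ hx

theorem exists_sum_of_mem_polySpan {s : R} {M : Submodule K N} {w : N}
    (hw : w ∈ polySpan K s M) :
    -- Allowing every large `n` lets two such sums be brought to a common length.
    ∃ a : ℕ → N, (∀ k, a k ∈ M) ∧ ∃ m, ∀ n ≥ m, w = ∑ k ∈ Finset.range n, s ^ k • a k := by
  induction hw using Submodule.span_induction with
  | mem w hw =>
    obtain ⟨k, a, ha, rfl⟩ := hw
    refine ⟨fun i => if i = k then a else 0, fun i => ?_, k + 1, fun n hn => ?_⟩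
    · dsimp only; split_ifs
      exacts [ha, M.zero_mem]
    · simp only [smul_ite, smul_zero]
      rw [Finset.sum_ite_eq', if_pos (Finset.mem_range.2 hn)]
  | zero => exact ⟨0, fun _ => M.zero_mem, 0, by simp⟩
  | add x y _ _ hx hy =>
    obtain ⟨a, ha, m, hm⟩ := hx
    obtain ⟨b, hb, l, hl⟩ := hy
    refine ⟨a + b, fun k => M.add_mem (ha k) (hb k), max m l, fun n hn => ?_⟩
    rw [hm n (le_trans (le_max_left _ _) hn), hl n (le_trans (le_max_right _ _) hn),
      ← Finset.sum_add_distrib]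
    simp
  | smul r x _ hx =>
    obtain ⟨a, ha, m, hm⟩ := hx
    refine ⟨r • a, fun k => M.smul_mem r (ha k), m, fun n hn => ?_⟩
    rw [hm n hn, Finset.smul_sum]
    exact Finset.sum_congr rfl fun k _ => smul_comm _ _ _

/-- The elements which become polynomials in `s` with coefficients in `M` after multiplication
with a power of `u`. -/
def sliceSpan (s u : R) (M : Submodule K N) (hM : ∀ w ∈ M, u • w ∈ M) : Submodule K N where
  carrier := {w | ∃ n : ℕ, u ^ n • w ∈ polySpan K s M}
  zero_mem' := ⟨0, by simp⟩
  add_mem' := by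
    have h : ∀ (n : ℕ) {w : N}, w ∈ polySpan K s M → u ^ n • w ∈ polySpan K s M := by
      intro n
      induction n with
      | zero => intro w hw; simpa using hw
      | succ n ih =>
        intro w hw
        rw [pow_succ', mul_smul]
        exact smul_mem_polySpan_of_forall hM (ih hw)
    rintro x y ⟨n, hn⟩ ⟨m, hm⟩
    refine ⟨n + m, ?_⟩
    rw [smul_add]
    refine Submodule.add_mem _ ?_ ?_
    · rw [pow_add, mul_comm, mul_smul]; exact h m hn
    · rw [pow_add, mul_smul]; exact h n hm
  smul_mem' := by
    rintro a x ⟨n, hn⟩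
    exact ⟨n, by rw [smul_comm]; exact Submodule.smul_mem _ _ hn⟩

section

variable {s u : R} {M : Submodule K N} {hM : ∀ w ∈ M, u • w ∈ M}

theorem le_sliceSpan : M ≤ sliceSpan s u M hM := fun w hw =>
  ⟨0, Submodule.subset_span ⟨0, w, hw, by simp⟩⟩

theorem smul_mem_sliceSpan_of_forall {r : R} (hr : ∀ w ∈ M, r • w ∈ M) {w : N}
    (hw : w ∈ sliceSpan s u M hM) : r • w ∈ sliceSpan s u M hM := by
  obtain ⟨n, hn⟩ := hw
  exact ⟨n, by rw [smul_comm]; exact smul_mem_polySpan_of_forall hr hn⟩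

theorem self_smul_mem_sliceSpan {w : N} (hw : w ∈ sliceSpan s u M hM) :
    s • w ∈ sliceSpan s u M hM := by
  obtain ⟨n, hn⟩ := hw
  exact ⟨n, by rw [smul_comm]; exact self_smul_mem_polySpan hn⟩

theorem mem_sliceSpan_of_smul_mem {w : N} (hw : u • w ∈ sliceSpan s u M hM) :
    w ∈ sliceSpan s u M hM := by
  obtain ⟨n, hn⟩ := hw
  exact ⟨n + 1, by rwa [pow_succ, mul_smul]⟩

end

/-- If `M` consists of constants and is saturated with respect to the constant `u`, where
`s / u` is a slice, then `M` contains all constants of `sliceSpan s u M`. -/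
theorem mem_of_mem_sliceSpan [CharZero K] {D : N →+ N} {δ : Derivation K R R}
    (hD : ∀ (p : R) (w : N), D (p • w) = δ p • w + p • D w) {s u : R} (hs : δ s = u)
    (hδ : δ u = 0) (hu : ∀ w : N, u • w = 0 → w = 0) {M : Submodule K N}
    {hM : ∀ w ∈ M, u • w ∈ M} (hM0 : ∀ w ∈ M, D w = 0)
    (hsat : ∀ w, D w = 0 → u • w ∈ M → w ∈ M) {w : N} (hw : w ∈ sliceSpan s u M hM)
    (hDw : D w = 0) : w ∈ M := by
  obtain ⟨n, hn⟩ := hw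
  have hDu : ∀ w, D w = 0 → D (u • w) = 0 := fun w h => by
    rw [hD, hδ, zero_smul, h, smul_zero, add_zero]
  have hDn : ∀ n : ℕ, D (u ^ n • w) = 0 := by
    intro n
    induction n with
    | zero => simpa using hDw
    | succ n ih => rw [pow_succ', mul_smul]; exact hDu _ ih
  have h1 : u ^ n • w ∈ M := by
    obtain ⟨a, ha, m, hm⟩ := exists_sum_of_mem_polySpan hn
    have e := hm (m + 1) (by omega)
    -- Only the term `a 0` survives, so `u ^ n • w` lies in `M`; saturation then removes the factors
    -- `u` one at a time.
    have h := slice_coeff_eq_zero hD hs hu (fun k => hM0 _ (ha k)) (e ▸ hDn n) hδ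
    rw [e, Finset.sum_range_succ', Finset.sum_eq_zero, zero_add, pow_zero, one_smul]
    · exact ha 0
    · intro k hk
      rw [h k (Finset.mem_range.1 hk), smul_zero]
  clear hn
  induction n with
  | zero => simpa using h1
  | succ n ih => exact ih (hsat _ (hDn n) (by rwa [← mul_smul, ← pow_succ']))

end Slice

/-! ### Triangular representations and the structure of `F_d'` -/

section

section Triangular

/-- The upper triangular `2 × 2` matrices. -/
def upperTriangular (K R : Type*) [Field K] [CommRing R] [Algebra K R] :
    Subalgebra K (Matrix (Fin 2) (Fin 2) R) where
  carrier := {M | M 1 0 = 0}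
  mul_mem' {a b} ha hb := by
    simp only [Set.mem_ofPred_eq] at *
    simp [Matrix.mul_apply, ha, hb]
  add_mem' {a b} ha hb := by
    simp only [Set.mem_ofPred_eq] at *
    simp [ha, hb]
  algebraMap_mem' r := by
    simp [Matrix.algebraMap_matrix_apply]

variable {K R : Type*} [Field K] [CommRing R] [Algebra K R]

/-- Commutators are strictly upper triangular because `R` is commutative, and two strictly upper
triangular `2 × 2` matrices have product zero. -/
theorem upperTriangular_metabelian (p q r s : upperTriangular K R) :
    (p * q - q * p) * (r * s - s * r) = 0 := by
  obtain ⟨p, hp⟩ := p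
  obtain ⟨q, hq⟩ := q
  obtain ⟨r, hr⟩ := r
  obtain ⟨s, hs⟩ := s
  change p 1 0 = 0 at hp
  change q 1 0 = 0 at hq
  change r 1 0 = 0 at hr
  change s 1 0 = 0 at hs
  ext i j
  fin_cases i <;> fin_cases j <;>
    (simp [Matrix.mul_apply, hp, hq, hr, hs]; try ring)

end Triangular

variable {K : Type*} [Field K] {d : ℕ}

/-- The representation `x_i ↦ !![u_i, g_i; 0, u_i + v_i]` of `F_d`. -/
def triangularRep (g : Fin d → PolyUV K d) : F K d →ₐ[K] upperTriangular K (PolyUV K d) :=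
  liftF (fun i => ⟨!![X (Sum.inl i), g i; 0, X (Sum.inl i) + X (Sum.inr i)], rfl⟩)
    upperTriangular_metabelian

theorem triangularRep_x (g : Fin d → PolyUV K d) (i : Fin d) :
    (triangularRep g (x K d i) : Matrix (Fin 2) (Fin 2) (PolyUV K d)) =
      !![X (Sum.inl i), g i; 0, X (Sum.inl i) + X (Sum.inr i)] := by
  rw [triangularRep, liftF_x]

theorem triangularRep_one_zero (g : Fin d → PolyUV K d) (w : F K d) :
    (triangularRep g w : Matrix (Fin 2) (Fin 2) (PolyUV K d)) 1 0 = 0 :=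
  (triangularRep g w).2

theorem triangularRep_diag (g : Fin d → PolyUV K d) {w : F K d} (hw : w ∈ commIdeal K d) :
    (triangularRep g w : Matrix (Fin 2) (Fin 2) (PolyUV K d)) 0 0 = 0 ∧
      (triangularRep g w : Matrix (Fin 2) (Fin 2) (PolyUV K d)) 1 1 = 0 := by
  refine commIdeal_induction (P := fun w =>
    (triangularRep g w : Matrix (Fin 2) (Fin 2) (PolyUV K d)) 0 0 = 0 ∧
      (triangularRep g w : Matrix (Fin 2) (Fin 2) (PolyUV K d)) 1 1 = 0) ?_ ?_ ?_ ?_ ?_ ?_ hw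
  · intro p q
    simp [Matrix.mul_apply, triangularRep_one_zero, mul_comm]
  · simp
  · rintro a b _ _ ⟨h1, h2⟩ ⟨h3, h4⟩; simp [h1, h2, h3, h4]
  · rintro a ⟨h1, h2⟩; simp [h1, h2]
  · rintro a b _ ⟨h1, h2⟩; simp [Matrix.mul_apply, triangularRep_one_zero, h1, h2]
  · rintro a b _ ⟨h1, h2⟩; simp [Matrix.mul_apply, triangularRep_one_zero, h1, h2]

/-- The `K[U_d,V_d]`-linear map `F_d' → K[U_d,V_d]` which sends `[x_i,x_j]` to
`g_i v_j - g_j v_i`. -/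
def corner (g : Fin d → PolyUV K d) : commIdeal K d →ₗ[PolyUV K d] PolyUV K d where
  toFun w := (triangularRep g (w : F K d) : Matrix (Fin 2) (Fin 2) (PolyUV K d)) 0 1
  map_add' a b := by simp
  map_smul' p w := by
    induction p using MvPolynomial.induction_on generalizing w with
    | C a =>
      have h : (C a : PolyUV K d) • w = a • w := by rw [← algebraMap_eq, algebraMap_smul]
      rw [h, RingHom.id_apply, smul_eq_mul, C_mul', Submodule.coe_smul, map_smul]
      rfl
    | add p q hp hq => rw [add_smul, RingHom.id_apply, add_smul, ← RingHom.id_apply p,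
        ← RingHom.id_apply q, ← hp, ← hq]; simp
    | mul_X p s h =>
      -- The matrix of `w` has zero diagonal, so left multiplication by `x_j` scales the corner by
      -- `u_j` and right multiplication scales it by `u_j + v_j`.
      have hX : (triangularRep g (((X s : PolyUV K d) • w : commIdeal K d) : F K d) :
          Matrix (Fin 2) (Fin 2) (PolyUV K d)) 0 1 = X s *
          (triangularRep g (w : F K d) : Matrix (Fin 2) (Fin 2) (PolyUV K d)) 0 1 := by
        obtain ⟨h0, h1⟩ := triangularRep_diag g w.2
        rcases s with j | j
        · rw [u_smul, map_mul]
          simp [Matrix.mul_apply, triangularRep_x, h1]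
        · rw [v_smul, map_sub, map_mul, map_mul]
          simp only [Subalgebra.coe_sub, Subalgebra.coe_mul, Matrix.sub_apply, Matrix.mul_apply,
            Fin.sum_univ_two, triangularRep_x, h0, h1]
          simp
          ring
      rw [mul_smul, h, hX]
      simp [mul_assoc]

theorem corner_commutator (g : Fin d → PolyUV K d) (i j : Fin d) :
    corner g (commutator (x K d i) (x K d j)) =
      g i * X (Sum.inr j) - g j * X (Sum.inr i) := by
  simp [corner, commutator, triangularRep_x]
  ring

theorem F_induction {P : F K d → Prop} (hC : ∀ a : K, P (algebraMap K _ a))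
    (hx : ∀ i, P (x K d i)) (hadd : ∀ a b, P a → P b → P (a + b))
    (hmul : ∀ a b, P a → P b → P (a * b)) (w : F K d) : P w := by
  obtain ⟨w, rfl⟩ := proj_surjective K d w
  induction w using FreeAlgebra.induction with
  | grade0 r => rw [AlgHom.commutes]; exact hC r
  | grade1 i => exact hx i
  | mul a b ha hb => rw [map_mul]; exact hmul _ _ ha hb
  | add a b ha hb => rw [map_add]; exact hadd _ _ ha hb

section

variable {M : Submodule (PolyUV K d) (commIdeal K d)}

/-- With the next lemma: a `K[U_d,V_d]`-submodule of `F_d'` is a two-sided ideal, since left and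
right multiplication by `x_i` are the actions of `u_i` and `u_i + v_i`. -/
theorem mul_mem_of_mem (a : F K d) (w : commIdeal K d) (hw : w ∈ M) :
    (⟨a * w, commIdeal_mul_mem_left a w.2⟩ : commIdeal K d) ∈ M := by
  induction a using F_induction generalizing w with
  | hC a =>
    convert M.smul_mem (C a) hw using 1
    rw [← algebraMap_eq, algebraMap_smul]
    ext
    simp [Algebra.smul_def]
  | hx i =>
    convert M.smul_mem (X (Sum.inl i)) hw using 1
    ext
    rw [u_smul]
  | hadd a b ha hb =>
    convert M.add_mem (ha w hw) (hb w hw) using 1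
    ext
    simp [add_mul]
  | hmul a b ha hb =>
    convert ha _ (hb w hw) using 1
    ext
    simp [mul_assoc]

theorem mul_mem_of_mem' (a : F K d) (w : commIdeal K d) (hw : w ∈ M) :
    (⟨w * a, commIdeal_mul_mem_right a w.2⟩ : commIdeal K d) ∈ M := by
  induction a using F_induction generalizing w with
  | hC a =>
    convert M.smul_mem (C a) hw using 1
    rw [← algebraMap_eq, algebraMap_smul]
    ext
    simp [Algebra.smul_def, Algebra.commutes]
  | hx i =>
    convert M.add_mem (M.smul_mem (X (Sum.inl i)) hw) (M.smul_mem (X (Sum.inr i)) hw) using 1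
    ext
    rw [Submodule.coe_add, u_smul, v_smul]
    abel
  | hadd a b ha hb =>
    convert M.add_mem (ha w hw) (hb w hw) using 1
    ext
    simp [mul_add]
  | hmul a b ha hb =>
    convert hb _ (ha w hw) using 1
    ext
    simp [mul_assoc]

/-- The Leibniz rule `[p, ab] = a[p, b] + [p, a]b`, used in each argument in turn, reduces to
generators. -/
theorem commutator_mem_of_forall (h : ∀ i j, commutator (x K d i) (x K d j) ∈ M) (p q : F K d) :
    commutator p q ∈ M := by
  have key : ∀ i q, commutator (x K d i) q ∈ M := by
    intro i q
    induction q using F_induction with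
    | hC a =>
      convert M.zero_mem
      ext
      simp [commutator, Algebra.commutes]
    | hx j => exact h i j
    | hadd a b ha hb =>
      convert M.add_mem ha hb using 1
      ext
      simp [commutator, mul_add, add_mul]; abel
    | hmul a b ha hb =>
      convert M.add_mem (mul_mem_of_mem a _ hb) (mul_mem_of_mem' b _ ha) using 1
      ext
      simp only [commutator, Submodule.coe_add]; noncomm_ring
  induction p using F_induction with
  | hC a =>
    convert M.zero_mem
    ext
    simp [commutator, Algebra.commutes]
  | hx i => exact key i q
  | hadd a b ha hb =>
    convert M.add_mem ha hb using 1
    ext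
    simp [commutator, mul_add, add_mul]; abel
  | hmul a b ha hb =>
    convert M.add_mem (mul_mem_of_mem a _ hb) (mul_mem_of_mem' b _ ha) using 1
    ext
    simp only [commutator, Submodule.coe_add]; noncomm_ring

theorem eq_top_of_commutator_mem (h : ∀ i j, commutator (x K d i) (x K d j) ∈ M) : M = ⊤ := by
  rw [eq_top_iff]
  rintro ⟨w, hw⟩ -
  refine (commIdeal_induction (P := fun w => ∃ h : w ∈ commIdeal K d, (⟨w, h⟩ : commIdeal K d) ∈ M)
    ?_ ?_ ?_ ?_ ?_ ?_ hw).2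
  · intro p q; exact ⟨comm_mem p q, commutator_mem_of_forall h p q⟩
  · exact ⟨Submodule.zero_mem _, M.zero_mem⟩
  · rintro a b ha hb ⟨_, h1⟩ ⟨_, h2⟩; exact ⟨Submodule.add_mem _ ha hb, M.add_mem h1 h2⟩
  · rintro a ⟨ha, h1⟩; exact ⟨Submodule.neg_mem _ ha, M.neg_mem h1⟩
  · rintro a b hb ⟨_, h1⟩; exact ⟨commIdeal_mul_mem_left _ hb, mul_mem_of_mem a _ h1⟩
  · rintro a b hb ⟨_, h1⟩; exact ⟨commIdeal_mul_mem_right _ hb, mul_mem_of_mem' a _ h1⟩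

end

variable (K)

theorem eq_top_of_mem {M : Submodule (PolyUV K 3) (commIdeal K 3)} (h1 : x₂₁ K ∈ M)
    (h2 : x₃₁ K ∈ M) (h3 : x₃₂ K ∈ M) : M = ⊤ := by
  have hs : ∀ p q : F K 3, commutator p q = -commutator q p := fun p q => by
    ext; simp [commutator]
  have h0 : ∀ p : F K 3, commutator p p = 0 := fun p => by
    ext; simp [commutator]
  have h1' := M.neg_mem h1
  have h2' := M.neg_mem h2
  have h3' := M.neg_mem h3
  rw [x₂₁, ← hs] at h1'
  rw [x₃₁, ← hs] at h2'
  rw [x₃₂, ← hs] at h3'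
  refine eq_top_of_commutator_mem fun i j => ?_
  fin_cases i <;> fin_cases j <;> first | assumption | (simp only [h0]; exact M.zero_mem)

theorem exists_smul_eq (w : commIdeal K 3) :
    ∃ a b c : PolyUV K 3, w = a • x₂₁ K + b • x₃₁ K + c • x₃₂ K := by
  have h : Submodule.span (PolyUV K 3) {x₂₁ K, x₃₁ K, x₃₂ K} = ⊤ :=
    eq_top_of_mem K (Submodule.subset_span (by simp)) (Submodule.subset_span (by simp))
      (Submodule.subset_span (by simp))
  obtain ⟨a, b, c, e⟩ := Submodule.mem_span_triple.1 (h ▸ Submodule.mem_top : w ∈ _)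
  exact ⟨a, b, c, e.symm⟩

/-- As `v_i` acts by `w ↦ [w, x_i]`, this is the Jacobi identity for `x_1, x_2, x_3`. -/
theorem jacobi : v₃ K • x₂₁ K - v₂ K • x₃₁ K + v₁ K • x₃₂ K = 0 := by
  ext
  simp only [v₁, v₂, v₃, Submodule.coe_add, Submodule.coe_sub, v_smul, x₂₁, x₃₁, x₃₂, commutator]
  simp only [Submodule.coe_zero]
  noncomm_ring

theorem corner_x₂₁ (g : Fin 3 → PolyUV K 3) : corner g (x₂₁ K) = g 1 * v₁ K - g 0 * v₂ K :=
  corner_commutator g 1 0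
theorem corner_x₃₁ (g : Fin 3 → PolyUV K 3) : corner g (x₃₁ K) = g 2 * v₁ K - g 0 * v₃ K :=
  corner_commutator g 2 0
theorem corner_x₃₂ (g : Fin 3 → PolyUV K 3) : corner g (x₃₂ K) = g 2 * v₂ K - g 1 * v₃ K :=
  corner_commutator g 2 1

/-- For `w = a x₂₁ + b x₃₁ + c x₃₂` the hypotheses read `a v₁ = c v₃` and `b v₁ = -c v₂`. Since `v₁`
is prime and does not divide `v₃`, it divides `c`, and `w` is a multiple of the Jacobi relation.
Torsion-freeness of `F_3'` over `u₁` follows. -/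
theorem eq_zero_of_corner {w : commIdeal K 3} (h1 : corner ![0, 1, 0] w = 0)
    (h2 : corner ![0, 0, 1] w = 0) : w = 0 := by
  obtain ⟨a, b, c, rfl⟩ := exists_smul_eq K w
  simp only [map_add, map_smul, corner_x₂₁, corner_x₃₁, corner_x₃₂, smul_eq_mul] at h1 h2
  simp at h1 h2
  have hv : v₁ K ≠ 0 := X_ne_zero _
  have hdvd : v₁ K ∣ c := by
    have h3 : v₁ K ∣ c * v₃ K := ⟨a, by linear_combination -h1⟩
    refine ((X_prime (R := K) (i := (Sum.inr 0 : Fin 3 ⊕ Fin 3))).dvd_or_dvd h3).resolve_right ?_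
    intro h
    change (X _ : PolyUV K 3) ∣ X _ at h
    simp [X_dvd_X] at h
  obtain ⟨t, rfl⟩ := hdvd
  have ha : a = t * v₃ K := mul_right_cancel₀ hv (by linear_combination h1)
  have hb : b = -(t * v₂ K) := mul_right_cancel₀ hv (by linear_combination h2)
  subst ha hb
  linear_combination (norm := module) t • jacobi K

theorem u₁_smul_eq_zero {w : commIdeal K 3} (h : u₁ K • w = 0) : w = 0 := by
  have hu : u₁ K ≠ 0 := X_ne_zero _
  refine eq_zero_of_corner K ?_ ?_ <;> refine (mul_eq_zero.1 ?_).resolve_left hu <;>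
    rw [← smul_eq_mul, ← map_smul, h, map_zero]

end

/-! ### The six relations -/

section

variable (K : Type*) [Field K]

theorem relations :
    f₆ K • c₁ K = f₂ K • c₃ K - f₁ K • c₂ K ∧
      f₆ K • c₂ K = f₂ K ^ 2 • c₄ K - (f₁ K * f₄ K + f₂ K * f₅ K) • c₁ K ∧
      f₆ K • c₃ K = (f₁ K * f₂ K) • c₄ K + (f₁ K * f₅ K + f₂ K * f₃ K) • c₁ K ∧
      f₆ K • c₄ K = f₃ K • c₂ K + f₅ K • c₃ K + f₁ K • c₅ K ∧
      f₂ K • c₅ K = f₅ K • c₂ K + f₄ K • c₃ K ∧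
      f₆ K • c₅ K = (f₃ K * f₄ K - f₅ K ^ 2) • c₁ K + (f₁ K * f₄ K + f₂ K * f₅ K) • c₄ K := by
  have e1 : (f₁ K : PolyUV K 3) = u₁ K := rfl
  have e2 : (f₂ K : PolyUV K 3) = v₁ K := rfl
  have e3 : (f₃ K : PolyUV K 3) = u₂ K ^ 2 - 2 * u₁ K * u₃ K := rfl
  have e4 : (f₄ K : PolyUV K 3) = v₂ K ^ 2 - 2 * v₁ K * v₃ K := rfl
  have e5 : (f₅ K : PolyUV K 3) = u₁ K * v₃ K - u₂ K * v₂ K + u₃ K * v₁ K := rfl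
  have e6 : (f₆ K : PolyUV K 3) = u₁ K * v₂ K - u₂ K * v₁ K := rfl
  have hJ := jacobi K
  simp only [Subalgebra.smul_def, Subalgebra.coe_add, Subalgebra.coe_sub, Subalgebra.coe_mul,
    Subalgebra.coe_pow, e1, e2, e3, e4, e5, e6, c₁, c₂, c₃, c₄, c₅]
  -- What remains are identities in a module generated by `a, b, c`, each holding up to a multiple
  -- of the Jacobi relation `hJ`; the first and the fourth need no correction.
  generalize x₂₁ K = a at *
  generalize x₃₁ K = b at *
  generalize x₃₂ K = c at *
  generalize u₁ K = p at *
  generalize u₂ K = q at *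
  generalize u₃ K = r at *
  generalize v₁ K = s at *
  generalize v₂ K = t at *
  generalize v₃ K = z at *
  refine ⟨?_, ?_, ?_, ?_, ?_, ?_⟩
  · module
  · linear_combination (norm := module) (-p * s) • hJ
  · linear_combination (norm := module) (-p ^ 2) • hJ
  · module
  · linear_combination (norm := module) (p * t - q * s) • hJ
  · linear_combination (norm := module)
      (-p * q * t + q ^ 2 * s + p ^ 2 * z - p * r * s) • hJ

end

/-! ### Linear independence and saturation by the specialization `u_1 = v_2 = 0` -/

section

variable (K : Type*) [Field K]

theorem fMonomial_eq (m : Fin 5 → ℕ) : fMonomial K m =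
    f₁ K ^ m 0 * f₂ K ^ m 1 * f₃ K ^ m 2 * f₄ K ^ m 3 * f₅ K ^ m 4 := by
  rw [fMonomial, Fin.prod_univ_five]
  rfl

theorem linearIndependent_monomials {I : Type*} {k : I → K} (hk : ∀ i, k i ≠ 0)
    {e : I → Fin 4 → ℕ} (he : Function.Injective e) : LinearIndependent K fun i =>
      C (k i) * (v₁ K ^ e i 0 * u₂ K ^ e i 1 * v₃ K ^ e i 2 * u₃ K ^ e i 3) := by
  let s : I → (Fin 3 ⊕ Fin 3) →₀ ℕ := fun i => Finsupp.equivFunOnFinite.symm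
    (Sum.elim ![0, e i 1, e i 3] ![e i 0, 0, e i 2])
  have hs : Function.Injective s := by
    intro i j h
    have h' := Finsupp.equivFunOnFinite.symm.injective h
    refine he (funext fun n => ?_)
    fin_cases n
    · exact congrFun h' (Sum.inr 0)
    · exact congrFun h' (Sum.inl 1)
    · exact congrFun h' (Sum.inr 2)
    · exact congrFun h' (Sum.inl 2)
  have h := ((basisMonomials (Fin 3 ⊕ Fin 3) K).linearIndependent.comp s hs).units_smul
    (fun i => Units.mk0 (k i) (hk i))
  refine linearIndependent_congr h fun i => ?_
  simp only [Pi.smul_apply', Function.comp_apply, coe_basisMonomials, Units.smul_mk0]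
  rw [smul_monomial, smul_eq_mul, mul_one, monomial_eq,
    Finsupp.prod_fintype _ _ (fun _ => pow_zero _), Fintype.prod_sum_type, Fin.prod_univ_three,
    Fin.prod_univ_three]
  simp only [v₁, v₃, u₂, u₃, s, Finsupp.equivFunOnFinite_symm_apply_apply, Sum.elim_inl,
    Sum.elim_inr]
  simp only [Matrix.cons_val]
  ring

/-- The specialization `u_1 = v_2 = 0`. -/
def specialize : PolyUV K 3 →ₐ[K] PolyUV K 3 :=
  aeval (Sum.elim ![0, u₂ K, u₃ K] ![v₁ K, 0, v₃ K])

theorem specialize_u₁ : specialize K (u₁ K) = 0 := by simp [specialize, u₁]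
theorem specialize_u₂ : specialize K (u₂ K) = u₂ K := by simp [specialize, u₂]
theorem specialize_u₃ : specialize K (u₃ K) = u₃ K := by simp [specialize, u₃]
theorem specialize_v₁ : specialize K (v₁ K) = v₁ K := by simp [specialize, v₁]
theorem specialize_v₂ : specialize K (v₂ K) = 0 := by simp [specialize, v₂]
theorem specialize_v₃ : specialize K (v₃ K) = v₃ K := by simp [specialize, v₃]

theorem specialize_f₁ : specialize K (f₁ K) = 0 := specialize_u₁ K
theorem specialize_f₂ : specialize K (f₂ K) = v₁ K := specialize_v₁ K
theorem specialize_f₃ : specialize K (f₃ K) = u₂ K ^ 2 := by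
  simp [f₃, specialize_u₁, specialize_u₂]
theorem specialize_f₄ : specialize K (f₄ K) = C (-2) * v₁ K * v₃ K := by
  simp [f₄, specialize_v₁, specialize_v₂, specialize_v₃, map_ofNat (specialize K) 2,
    map_ofNat C 2]
theorem specialize_f₅ : specialize K (f₅ K) = u₃ K * v₁ K := by
  simp [f₅, specialize_u₁, specialize_u₃, specialize_v₁, specialize_v₂]
theorem specialize_f₆ : specialize K (f₆ K) = -(u₂ K * v₁ K) := by
  simp [f₆, specialize_u₁, specialize_u₂, specialize_v₁]

/-- Setting `v₂ = 0` besides `u₁ = 0` is what makes this a monomial: it removes the square from `f₄`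
and the mixed term from `f₅`. The entries of `m` are the exponents of `f₂, …, f₅`. -/
theorem specialize_fMonomial (m : Fin 4 → ℕ) :
    specialize K (fMonomial K (Fin.cons 0 m)) = C ((-2) ^ m 2) *
      (v₁ K ^ (m 0 + m 2 + m 3) * u₂ K ^ (2 * m 1) * v₃ K ^ m 2 * u₃ K ^ m 3) := by
  rw [fMonomial_eq]
  simp only [Subalgebra.coe_mul, Subalgebra.coe_pow, map_mul, map_pow, specialize_f₁,
    specialize_f₂, specialize_f₃, specialize_f₄, specialize_f₅]
  change 0 ^ 0 * _ ^ m 0 * _ ^ m 1 * _ ^ m 2 * _ ^ m 3 = _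
  ring

theorem fMonomial_cons (n : ℕ) (m : Fin 4 → ℕ) :
    fMonomial K (Fin.cons n m) = f₁ K ^ n * fMonomial K (Fin.cons 0 m) := by
  simp only [fMonomial_eq, Fin.cons_zero, pow_zero, one_mul, mul_assoc]
  rfl

/-- The elements of the basis of `K[U_3,V_3]^δ`. -/
def polyBasis (a : (Fin 5 → ℕ) × Fin 2) : polyConst (cell3 K) :=
  fMonomial K a.1 * f₆ K ^ (a.2 : ℕ)

/-- The elements of the basis of `(F_3')^δ`. -/
def commBasis (a : {a : Fin 5 × (Fin 5 → ℕ) // a.1 = 4 → a.2 1 = 0}) : commIdeal K 3 :=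
  fMonomial K a.1.2 • c K a.1.1

/-- The `K`-linear map of restriction to `u_1 = v_2 = 0` on `K[U_3,V_3]^δ`. -/
def polySpecialize : polyConst (cell3 K) →ₗ[K] PolyUV K 3 :=
  ((specialize K).comp (polyConst (cell3 K)).val).toLinearMap

theorem polySpecialize_apply (p : polyConst (cell3 K)) :
    polySpecialize K p = specialize K p := rfl

theorem linearIndependent_polySpecialize [CharZero K] :
    LinearIndependent K fun a : (Fin 4 → ℕ) × Fin 2 =>
      polySpecialize K (polyBasis K (Fin.cons 0 a.1, a.2)) := by
  have h := linearIndependent_monomials K (I := (Fin 4 → ℕ) × Fin 2)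
    (k := fun a => (-2) ^ a.1 2 * (-1) ^ (a.2 : ℕ))
    (fun a => mul_ne_zero (pow_ne_zero _ (by norm_num)) (pow_ne_zero _ (by norm_num)))
    -- The parity of the exponent of `u₂` recovers the exponent of `f₆`, after which the others are
    -- determined.
    (e := fun a => ![a.1 0 + a.1 2 + a.1 3 + a.2, 2 * a.1 1 + a.2, a.1 2, a.1 3]) (by
      rintro ⟨m, e⟩ ⟨m', e'⟩ h
      have h0 := congrFun h 0
      have h1 := congrFun h 1
      have h2 := congrFun h 2
      have h3 := congrFun h 3
      simp at h0 h1 h2 h3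
      have := e.2
      have := e'.2
      have he : e = e' := Fin.ext (by omega)
      subst he
      refine Prod.ext (funext fun i => ?_) rfl
      fin_cases i <;> simp <;> omega)
  refine linearIndependent_congr h fun ⟨m, e⟩ => ?_
  rw [polySpecialize_apply, polyBasis, Subalgebra.coe_mul, Subalgebra.coe_pow, map_mul, map_pow,
    specialize_fMonomial, specialize_f₆]
  simp
  ring

/-- The `K`-linear map of restriction to `u_1 = v_2 = 0` on `F_3'`. -/
def commSpecialize : commIdeal K 3 →ₗ[K] PolyUV K 3 × PolyUV K 3 :=
  ((specialize K).toLinearMap ∘ₗ (corner ![0, 1, 0]).restrictScalars K).prod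
    ((specialize K).toLinearMap ∘ₗ (corner ![0, 0, 1]).restrictScalars K)

theorem commSpecialize_smul (p : polyConst (cell3 K)) (w : commIdeal K 3) :
    commSpecialize K (p • w) = (specialize K p * (commSpecialize K w).1,
      specialize K p * (commSpecialize K w).2) := by
  rw [Subalgebra.smul_def]
  simp [commSpecialize]

theorem commSpecialize_x₂₁ : commSpecialize K (x₂₁ K) = (v₁ K, 0) := by
  simp [commSpecialize, corner_x₂₁, specialize_v₁]
theorem commSpecialize_x₃₁ : commSpecialize K (x₃₁ K) = (0, v₁ K) := by
  simp [commSpecialize, corner_x₃₁, specialize_v₁]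
theorem commSpecialize_x₃₂ : commSpecialize K (x₃₂ K) = (-v₃ K, 0) := by
  simp [commSpecialize, corner_x₃₂, specialize_v₂, specialize_v₃]
theorem commSpecialize_smul' (p : PolyUV K 3) (w : commIdeal K 3) :
    commSpecialize K (p • w) = (specialize K p * (commSpecialize K w).1,
      specialize K p * (commSpecialize K w).2) := by
  simp [commSpecialize]

theorem commSpecialize_c : (fun j => commSpecialize K (c K j)) =
    ![(v₁ K, 0), (0, v₁ K ^ 2), (-(u₂ K * v₁ K), 0), (u₃ K * v₁ K, -(u₂ K * v₁ K)),
      (2 * u₂ K * v₁ K * v₃ K, u₃ K * v₁ K ^ 2)] := by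
  funext j
  fin_cases j <;> simp [c, c₁, c₂, c₃, c₄, c₅, commSpecialize_smul', commSpecialize_x₂₁,
    commSpecialize_x₃₁, commSpecialize_x₃₂, specialize_u₁, specialize_u₂, specialize_u₃,
    specialize_v₁, specialize_v₂, specialize_v₃]
  · ring
  · constructor <;> ring

/-- By `commSpecialize_c`, the second component vanishes exactly for `c₁` and `c₃`. It therefore
handles `c₂, c₄, c₅`, and the first component handles `c₁, c₃`. -/
theorem linearIndependent_commSpecialize [CharZero K] :
    LinearIndependent K fun a : {a : Fin 5 × (Fin 4 → ℕ) // a.1 = 4 → a.2 0 = 0} =>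
      commSpecialize K (commBasis K ⟨(a.1.1, Fin.cons 0 a.1.2), a.2⟩) := by
  refine linearIndependent_of_block (fun a => a.1.1 = 1 ∨ a.1.1 = 3 ∨ a.1.1 = 4)
    (LinearMap.snd K _ _) (LinearMap.fst K _ _) ?_ ?_ ?_
  · rintro ⟨⟨j, m⟩, h⟩ hj
    have := congrFun (commSpecialize_c K) j
    simp only [commBasis, LinearMap.snd_apply, commSpecialize_smul, this]
    fin_cases j <;> simp at hj ⊢
  · have h := linearIndependent_monomials K
      (I := {i : {a : Fin 5 × (Fin 4 → ℕ) // a.1 = 4 → a.2 0 = 0} //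
        i.1.1 = 1 ∨ i.1.1 = 3 ∨ i.1.1 = 4})
      (k := fun a => (-2) ^ a.1.1.2 2 * ![1, 1, 1, -1, 1] a.1.1.1)
      (fun a => mul_ne_zero (pow_ne_zero _ (by norm_num)) (by
        generalize a.1.1.1 = j
        fin_cases j <;> simp))
      -- An odd exponent of `u₂` singles out `c₄`. The `v₁`-exponent minus those of `v₃` and `u₃` is
      -- at least `2` for `c₂` but equals `1` for `c₅`, because `f₂` is excluded there. Entries at
      -- the indices of `c₁` and `c₃` are placeholders.
      (e := fun a => ![a.1.1.2 0 + a.1.1.2 2 + a.1.1.2 3 + ![0, 2, 0, 1, 2] a.1.1.1,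
        2 * a.1.1.2 1 + ![0, 0, 0, 1, 0] a.1.1.1, a.1.1.2 2,
        a.1.1.2 3 + ![0, 0, 0, 0, 1] a.1.1.1]) (by
        rintro ⟨⟨⟨j, m⟩, hm⟩, hj⟩ ⟨⟨⟨j', m'⟩, hm'⟩, hj'⟩ h
        have h0 := congrFun h 0
        have h1 := congrFun h 1
        have h2 := congrFun h 2
        have h3 := congrFun h 3
        dsimp at hj hj' hm hm'
        rcases hj with rfl | rfl | rfl <;> rcases hj' with rfl | rfl | rfl <;>
          simp at h0 h1 h2 h3 hm hm' <;> first | omega | skip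
        all_goals
          refine Subtype.ext (Subtype.ext (Prod.ext rfl (funext fun i => ?_)))
          fin_cases i <;> simp <;> omega)
    refine linearIndependent_congr h fun ⟨⟨⟨j, m⟩, hm⟩, hj⟩ => ?_
    have := congrFun (commSpecialize_c K) j
    simp only [commBasis, LinearMap.snd_apply, commSpecialize_smul, this, specialize_fMonomial]
    dsimp at hj
    rcases hj with rfl | rfl | rfl <;> simp <;> ring
  · have h := linearIndependent_monomials K
      (I := {i : {a : Fin 5 × (Fin 4 → ℕ) // a.1 = 4 → a.2 0 = 0} //
        ¬ (i.1.1 = 1 ∨ i.1.1 = 3 ∨ i.1.1 = 4)})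
      (k := fun a => (-2) ^ a.1.1.2 2 * ![1, 1, -1, 1, 1] a.1.1.1)
      (fun a => mul_ne_zero (pow_ne_zero _ (by norm_num)) (by
        generalize a.1.1.1 = j
        fin_cases j <;> simp))
      -- Again the parity of the exponent of `u₂` separates `c₁` from `c₃`.
      (e := fun a => ![a.1.1.2 0 + a.1.1.2 2 + a.1.1.2 3 + 1,
        2 * a.1.1.2 1 + ![0, 0, 1, 0, 0] a.1.1.1, a.1.1.2 2, a.1.1.2 3]) (by
        rintro ⟨⟨⟨j, m⟩, hm⟩, hj⟩ ⟨⟨⟨j', m'⟩, hm'⟩, hj'⟩ h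
        have h0 := congrFun h 0
        have h1 := congrFun h 1
        have h2 := congrFun h 2
        have h3 := congrFun h 3
        have hj : j = 0 ∨ j = 2 := by dsimp at hj; omega
        have hj' : j' = 0 ∨ j' = 2 := by dsimp at hj'; omega
        rcases hj with rfl | rfl <;> rcases hj' with rfl | rfl <;>
          simp at h0 h1 h2 h3 <;> first | omega | skip
        all_goals
          refine Subtype.ext (Subtype.ext (Prod.ext rfl (funext fun i => ?_)))
          fin_cases i <;> simp <;> omega)
    refine linearIndependent_congr h fun ⟨⟨⟨j, m⟩, hm⟩, hj⟩ => ?_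
    have := congrFun (commSpecialize_c K) j
    simp only [commBasis, LinearMap.fst_apply, commSpecialize_smul, this, specialize_fMonomial]
    have hj : j = 0 ∨ j = 2 := by dsimp at hj; omega
    rcases hj with rfl | rfl <;> simp <;> ring

theorem f₁_smul_injective :
    Function.Injective (Algebra.lsmul K K (commIdeal K 3) (f₁ K)) := by
  rw [injective_iff_map_eq_zero]
  intro w hw
  exact u₁_smul_eq_zero K hw

theorem f₁_mul_injective :
    Function.Injective (LinearMap.mulLeft K (f₁ K)) := by
  rw [injective_iff_map_eq_zero]
  intro w hw
  have h : u₁ K * (w : PolyUV K 3) = 0 := congrArg Subtype.val hw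
  exact Subtype.ext ((mul_eq_zero.1 h).resolve_left (X_ne_zero _))

theorem polySpecialize_f₁ (w : polyConst (cell3 K)) :
    polySpecialize K (LinearMap.mulLeft K (f₁ K) w) = 0 := by
  simp [polySpecialize_apply, specialize_f₁]

theorem commSpecialize_f₁ (w : commIdeal K 3) :
    commSpecialize K (Algebra.lsmul K K _ (f₁ K) w) = 0 := by
  simp [commSpecialize_smul, specialize_f₁]

/-- Splitting off the exponent of `f₁` brings the family into the shape of
`linearIndependent_pow_apply`; `commBasis_eq` does the same for the module. -/
theorem polyBasis_eq : polyBasis K = (fun a : ℕ × ((Fin 4 → ℕ) × Fin 2) =>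
    (LinearMap.mulLeft K (f₁ K) ^ a.1) (polyBasis K (Fin.cons 0 a.2.1, a.2.2))) ∘
      fun a => (a.1 0, (Fin.tail a.1, a.2)) := by
  funext ⟨m, e⟩
  obtain ⟨n, m, rfl⟩ : ∃ (n : ℕ) (m' : Fin 4 → ℕ), m = Fin.cons n m' :=
    ⟨m 0, Fin.tail m, (Fin.cons_self_tail m).symm⟩
  simp [polyBasis, LinearMap.pow_mulLeft, fMonomial_cons K n m, mul_assoc]

theorem commBasis_eq : commBasis K =
    (fun a : ℕ × {a : Fin 5 × (Fin 4 → ℕ) // a.1 = 4 → a.2 0 = 0} =>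
      (Algebra.lsmul K K _ (f₁ K) ^ a.1) (commBasis K ⟨(a.2.1.1, Fin.cons 0 a.2.1.2), a.2.2⟩)) ∘
      fun a => (a.1.2 0, ⟨(a.1.1, Fin.tail a.1.2), a.2⟩) := by
  funext ⟨⟨j, m⟩, h⟩
  obtain ⟨n, m, rfl⟩ : ∃ (n : ℕ) (m' : Fin 4 → ℕ), m = Fin.cons n m' :=
    ⟨m 0, Fin.tail m, (Fin.cons_self_tail m).symm⟩
  simp [commBasis, ← map_pow, fMonomial_cons K n m, mul_smul]

theorem linearIndependent_polyBasis [CharZero K] : LinearIndependent K (polyBasis K) := by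
  rw [polyBasis_eq]
  refine (linearIndependent_pow_apply (f₁_mul_injective K) (polySpecialize_f₁ K)
    (linearIndependent_polySpecialize K)).comp _ ?_
  rintro ⟨m, e⟩ ⟨m', e'⟩ h
  simp only [Prod.mk.injEq] at h
  obtain ⟨h1, h2, rfl⟩ := h
  rw [← Fin.cons_self_tail m, ← Fin.cons_self_tail m', h1, h2]

theorem mem_span_polyBasis_of_mul_mem [CharZero K] {w : polyConst (cell3 K)}
    (h : f₁ K * w ∈ Submodule.span K (Set.range (polyBasis K))) :
    w ∈ Submodule.span K (Set.range (polyBasis K)) := by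
  rw [polyBasis_eq, Function.Surjective.range_comp] at h ⊢
  · exact mem_span_pow_apply_of_apply_mem (f₁_mul_injective K) (polySpecialize_f₁ K)
      (linearIndependent_polySpecialize K) h
  all_goals exact fun ⟨n, m, e⟩ => ⟨(Fin.cons n m, e), rfl⟩

theorem linearIndependent_commBasis [CharZero K] : LinearIndependent K (commBasis K) := by
  rw [commBasis_eq]
  refine (linearIndependent_pow_apply (f₁_smul_injective K) (commSpecialize_f₁ K)
    (linearIndependent_commSpecialize K)).comp _ ?_
  rintro ⟨⟨j, m⟩, e⟩ ⟨⟨j', m'⟩, e'⟩ h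
  have h1 := congrArg (fun z => z.1) h
  have h0 := congrArg (fun z => z.2.1.1) h
  have h2 := congrArg (fun z => z.2.1.2) h
  dsimp only at h0 h1 h2
  refine Subtype.ext (Prod.ext h0 ?_)
  dsimp only
  rw [← Fin.cons_self_tail m, ← Fin.cons_self_tail m', h1, h2]

theorem mem_span_commBasis_of_smul_mem [CharZero K] {w : commIdeal K 3}
    (h : f₁ K • w ∈ Submodule.span K (Set.range (commBasis K))) :
    w ∈ Submodule.span K (Set.range (commBasis K)) := by
  rw [commBasis_eq, Function.Surjective.range_comp] at h ⊢
  · exact mem_span_pow_apply_of_apply_mem (f₁_smul_injective K) (commSpecialize_f₁ K)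
      (linearIndependent_commSpecialize K) h
  all_goals exact fun ⟨n, ⟨⟨j, m⟩, e⟩⟩ => ⟨⟨(j, Fin.cons n m), e⟩, rfl⟩

end

/-! ### Presentation of `K[U_3,V_3]^δ` -/

section

section

variable {K R N I : Type*} [Field K] [CommRing R] [Algebra K R] [AddCommGroup N] [Module K N]
  [Module R N] [IsScalarTower K R N]

theorem smul_mem_span_sup {m : I → N} {J : Submodule R N} {p : R}
    (hp : ∀ i, p • m i ∈ Submodule.span K (Set.range m) ⊔ J.restrictScalars K) {w : N}
    (hw : w ∈ Submodule.span K (Set.range m) ⊔ J.restrictScalars K) :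
    p • w ∈ Submodule.span K (Set.range m) ⊔ J.restrictScalars K := by
  obtain ⟨y, hy, z, hz, rfl⟩ := Submodule.mem_sup.1 hw
  rw [smul_add]
  refine Submodule.add_mem _ ?_ (Submodule.mem_sup_right (J.smul_mem p hz))
  clear hw
  induction hy using Submodule.span_induction with
  | mem w hw => obtain ⟨i, rfl⟩ := hw; exact hp i
  | zero => rw [smul_zero]; exact Submodule.zero_mem _
  | add x y _ _ hx hy => rw [smul_add]; exact Submodule.add_mem _ hx hy
  | smul a x _ hx => rw [smul_comm]; exact Submodule.smul_mem _ _ hx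

end

variable (K : Type*) [Field K]

theorem f₆_sq : f₆ K ^ 2 = f₁ K ^ 2 * f₄ K + f₂ K ^ 2 * f₃ K + 2 * f₁ K * f₂ K * f₅ K := by
  apply Subtype.ext
  change (u₁ K * v₂ K - u₂ K * v₁ K) ^ 2 = u₁ K ^ 2 * (v₂ K ^ 2 - 2 * v₁ K * v₃ K) +
    v₁ K ^ 2 * (u₂ K ^ 2 - 2 * u₁ K * u₃ K) +
      2 * u₁ K * v₁ K * (u₁ K * v₃ K - u₂ K * v₂ K + u₃ K * v₁ K)
  ring

/-- The relation between `f_1, …, f_6`. -/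
def polyRelation : MvPolynomial (Fin 6) K :=
  X 5 ^ 2 - (X 0 ^ 2 * X 3 + X 1 ^ 2 * X 2 + 2 * X 0 * X 1 * X 4)

/-- The monomials in six variables which are at most linear in the last one. -/
def normalMonomial (a : (Fin 5 → ℕ) × Fin 2) : MvPolynomial (Fin 6) K :=
  (∏ i : Fin 5, X i.castSucc ^ a.1 i) * X 5 ^ (a.2 : ℕ)

theorem aeval_polyRelation : aeval (f K) (polyRelation K) = 0 := by
  simp only [polyRelation, map_sub, map_add, map_mul, map_pow, aeval_X, map_ofNat]
  change f₆ K ^ 2 - (f₁ K ^ 2 * f₄ K + f₂ K ^ 2 * f₃ K + 2 * f₁ K * f₂ K * f₅ K) = 0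
  rw [f₆_sq, sub_self]

theorem aeval_normalMonomial (a : (Fin 5 → ℕ) × Fin 2) :
    aeval (f K) (normalMonomial K a) = polyBasis K a := by
  simp only [normalMonomial, map_mul, map_pow, map_prod, aeval_X]
  rfl

theorem X_mul_normalMonomial (i : Fin 5) (m : Fin 5 → ℕ) (e : Fin 2) :
    X i.castSucc * normalMonomial K (m, e) = normalMonomial K (Pi.single i 1 + m, e) := by
  simp only [normalMonomial, Pi.add_apply, pow_add, Finset.prod_mul_distrib]
  rw [← mul_assoc]
  congr 2
  rw [Finset.prod_eq_single i (fun j _ hj => by simp [hj]) (by simp)]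
  simp

/-- The left side contains `1` and is stable under every variable: only a second factor `X 5` leaves
the normal monomials, and the relation rewrites `X 5 ^ 2` without `X 5`. -/
theorem span_normalMonomial_sup : Submodule.span K (Set.range (normalMonomial K)) ⊔
    (Ideal.span {polyRelation K}).restrictScalars K = ⊤ := by
  set T := Submodule.span K (Set.range (normalMonomial K)) ⊔
    (Ideal.span {polyRelation K}).restrictScalars K with hT
  have hm : ∀ a, normalMonomial K a ∈ T := fun a =>
    Submodule.mem_sup_left (Submodule.subset_span ⟨a, rfl⟩)
  have h1 : ∀ i : Fin 5, ∀ w ∈ T, X i.castSucc * w ∈ T := fun i w hw =>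
    smul_mem_span_sup (fun ⟨m, e⟩ => by
      rw [smul_eq_mul, X_mul_normalMonomial]; exact hm _) hw
  have h2 : ∀ w ∈ T, X 5 * w ∈ T := by
    refine fun w hw => smul_mem_span_sup (fun ⟨m, e⟩ => ?_) hw
    rw [smul_eq_mul]
    fin_cases e
    · convert hm (m, 1) using 1
      simp [normalMonomial, mul_comm]
    · have e1 : X 5 * normalMonomial K (m, 1) = X 0 * (X 0 * (X 3 * normalMonomial K (m, 0))) +
          X 1 * (X 1 * (X 2 * normalMonomial K (m, 0))) +
          (2 : K) • (X 0 * (X 1 * (X 4 * normalMonomial K (m, 0)))) +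
          normalMonomial K (m, 0) * polyRelation K := by
        rw [smul_eq_C_mul, map_ofNat]
        simp only [normalMonomial, polyRelation, Fin.val_one, Fin.val_zero]
        ring
      have hm0 := hm (m, 0)
      refine e1 ▸ Submodule.add_mem _ (Submodule.add_mem _ (Submodule.add_mem _ ?_ ?_) ?_) ?_
      · exact h1 0 _ (h1 0 _ (h1 3 _ hm0))
      · exact h1 1 _ (h1 1 _ (h1 2 _ hm0))
      · exact Submodule.smul_mem _ _ (h1 0 _ (h1 1 _ (h1 4 _ hm0)))
      · exact Submodule.mem_sup_right
          (Ideal.mul_mem_left _ _ (Ideal.subset_span (Set.mem_singleton _)))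
  have h3 : ∀ i : Fin 6, ∀ w ∈ T, X i * w ∈ T := fun i =>
    Fin.lastCases (motive := fun i => ∀ w ∈ T, X i * w ∈ T) h2 h1 i
  rw [eq_top_iff]
  rintro p -
  induction p using MvPolynomial.induction_on with
  | C a =>
    convert T.smul_mem a (hm (0, 0)) using 1
    simp [normalMonomial, smul_eq_C_mul]
  | add p q hp hq => exact T.add_mem hp hq
  | mul_X p i hp => rw [mul_comm]; exact h3 i p hp

theorem span_polyBasis : Submodule.span K (Set.range (polyBasis K)) =
    Subalgebra.toSubmodule (aeval (f K) : MvPolynomial (Fin 6) K →ₐ[K] _).range := by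
  have h := congrArg (Submodule.map
    (aeval (f K) : MvPolynomial (Fin 6) K →ₐ[K] polyConst (cell3 K)).toLinearMap)
    (span_normalMonomial_sup K)
  rw [Submodule.map_sup, Submodule.map_span, ← Set.range_comp, Submodule.map_top] at h
  have h0 : Submodule.map (aeval (f K) : MvPolynomial (Fin 6) K →ₐ[K] polyConst (cell3 K)).toLinearMap
      ((Ideal.span {polyRelation K}).restrictScalars K) = ⊥ := by
    rw [eq_bot_iff]
    rintro _ ⟨w, hw, rfl⟩
    obtain ⟨z, rfl⟩ := Ideal.mem_span_singleton'.1 hw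
    simp [aeval_polyRelation]
  rw [h0, sup_bot_eq] at h
  have e : (aeval (f K) : MvPolynomial (Fin 6) K →ₐ[K] polyConst (cell3 K)).toLinearMap ∘
      normalMonomial K = polyBasis K := _root_.funext (aeval_normalMonomial K)
  rw [e] at h
  exact h

theorem ker_aeval_f [CharZero K] : RingHom.ker (aeval (f K) :
    MvPolynomial (Fin 6) K →ₐ[K] polyConst (cell3 K)) = Ideal.span {polyRelation K} := by
  apply le_antisymm
  · have h := ker_le_of_linearIndependent
      (φ := (aeval (f K) : MvPolynomial (Fin 6) K →ₐ[K] polyConst (cell3 K)).toLinearMap)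
      (m := normalMonomial K) (J := (Ideal.span {polyRelation K}).restrictScalars K)
      (linearIndependent_congr (linearIndependent_polyBasis K) (aeval_normalMonomial K)) ?_
      (span_normalMonomial_sup K)
    · intro w hw
      exact h hw
    · intro w hw
      obtain ⟨z, rfl⟩ := Ideal.mem_span_singleton'.1 hw
      simp [aeval_polyRelation]
  · rw [Ideal.span_singleton_le_iff_mem]
    exact aeval_polyRelation K

section Slice

variable {K} {N : Type*} [AddCommGroup N] [Module K N] [Module (PolyUV K 3) N]
  [IsScalarTower K (PolyUV K 3) N]

/-- Up to division by `u₁`, which `sliceSpan` permits, all variables come from `u₂` and the `f_i`: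
`f₃` yields `u₃`, `f₆` yields `v₂`, and then `f₅` yields `v₃`. -/
theorem smul_mem_sliceSpan [CharZero K] {M : Submodule K N}
    (hM : ∀ i, ∀ w ∈ M, (f K i : PolyUV K 3) • w ∈ M) (p : PolyUV K 3) {w : N}
    (hw : w ∈ sliceSpan (u₂ K) (u₁ K) M (hM 0)) :
    p • w ∈ sliceSpan (u₂ K) (u₁ K) M (hM 0) := by
  set S := sliceSpan (u₂ K) (u₁ K) M (hM 0) with hS
  have hf : ∀ i, ∀ w ∈ S, (f K i : PolyUV K 3) • w ∈ S := fun i w hw =>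
    smul_mem_sliceSpan_of_forall (hM i) hw
  have hu1 : ∀ w ∈ S, u₁ K • w ∈ S := hf 0
  have hv1 : ∀ w ∈ S, v₁ K • w ∈ S := hf 1
  have hu2 : ∀ w ∈ S, u₂ K • w ∈ S := fun w hw => self_smul_mem_sliceSpan hw
  have hu3 : ∀ w ∈ S, u₃ K • w ∈ S := by
    intro w hw
    refine mem_sliceSpan_of_smul_mem (?_ : u₁ K • u₃ K • w ∈ S)
    have e : u₁ K • u₃ K • w = (2⁻¹ : K) • (u₂ K • u₂ K • w - (f K 2 : PolyUV K 3) • w) := by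
      rw [eq_inv_smul_iff₀ two_ne_zero, ← algebraMap_smul (PolyUV K 3) (2 : K), map_ofNat]
      change _ = _ - (u₂ K ^ 2 - 2 * u₁ K * u₃ K) • w
      module
    rw [e]
    exact S.smul_mem _ (S.sub_mem (hu2 _ (hu2 _ hw)) (hf 2 _ hw))
  have hv2 : ∀ w ∈ S, v₂ K • w ∈ S := by
    intro w hw
    refine mem_sliceSpan_of_smul_mem (?_ : u₁ K • v₂ K • w ∈ S)
    have e : u₁ K • v₂ K • w = (f K 5 : PolyUV K 3) • w + u₂ K • v₁ K • w := by
      change _ = (u₁ K * v₂ K - u₂ K * v₁ K) • w + _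
      module
    rw [e]
    exact S.add_mem (hf 5 _ hw) (hu2 _ (hv1 _ hw))
  have hv3 : ∀ w ∈ S, v₃ K • w ∈ S := by
    intro w hw
    refine mem_sliceSpan_of_smul_mem (?_ : u₁ K • v₃ K • w ∈ S)
    have e : u₁ K • v₃ K • w = (f K 4 : PolyUV K 3) • w + u₂ K • v₂ K • w - u₃ K • v₁ K • w := by
      change _ = (u₁ K * v₃ K - u₂ K * v₂ K + u₃ K * v₁ K) • w + _ - _
      module
    rw [e]
    exact S.sub_mem (S.add_mem (hf 4 _ hw) (hu2 _ (hv2 _ hw))) (hu3 _ (hv1 _ hw))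
  induction p using MvPolynomial.induction_on generalizing w with
  | C a => rw [← algebraMap_eq, algebraMap_smul]; exact S.smul_mem _ hw
  | add p q hp hq => rw [add_smul]; exact S.add_mem (hp hw) (hq hw)
  | mul_X p i hp =>
    rw [mul_smul]
    refine hp ?_
    rcases i with i | i <;> fin_cases i
    exacts [hu1 _ hw, hu2 _ hw, hu3 _ hw, hv1 _ hw, hv2 _ hw, hv3 _ hw]

end Slice

/-- The slice argument with `M = K[f_1, …, f_6]`: the slice span contains `1` and hence everything,
and saturation is `mem_span_polyBasis_of_mul_mem`. -/
theorem range_aeval_f [CharZero K] : (aeval (f K) :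
    MvPolynomial (Fin 6) K →ₐ[K] polyConst (cell3 K)).range = ⊤ := by
  set B := (aeval (f K) : MvPolynomial (Fin 6) K →ₐ[K] polyConst (cell3 K)).range with hB
  set M : Submodule K (PolyUV K 3) := Subalgebra.toSubmodule (B.map (polyConst (cell3 K)).val)
  have hfB : ∀ i, f K i ∈ B := fun i => ⟨X i, by simp⟩
  have hM : ∀ i, ∀ w ∈ M, (f K i : PolyUV K 3) • w ∈ M := by
    rintro i _ ⟨w, hw, rfl⟩
    exact ⟨f K i * w, B.mul_mem (hfB i) hw, rfl⟩
  rw [eq_top_iff]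
  rintro p -
  have h1 : (1 : PolyUV K 3) ∈ M := ⟨1, B.one_mem, rfl⟩
  have h := mem_of_mem_sliceSpan (D := (polyDer (cell3 K)).toLinearMap.toAddMonoidHom)
    (δ := polyDer (cell3 K)) (s := u₂ K) (u := u₁ K) (M := M) (hM := hM 0) (w := p)
    (fun p w => by simp [mul_comm, add_comm]) (polyDer_u₂ K) (polyDer_u₁ K)
    (fun w hw => (mul_eq_zero.1 hw).resolve_left (X_ne_zero _))
    (by rintro _ ⟨w, _, rfl⟩; exact w.2)
    (by
      rintro w hw ⟨z, hz, e⟩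
      refine ⟨⟨w, hw⟩, ?_, rfl⟩
      have : f₁ K * ⟨w, hw⟩ ∈ Submodule.span K (Set.range (polyBasis K)) := by
        have e' : f₁ K * ⟨w, hw⟩ = z := Subtype.ext e.symm
        rwa [span_polyBasis, e']
      have := mem_span_polyBasis_of_mul_mem K this
      rwa [span_polyBasis] at this)
    (by simpa using smul_mem_sliceSpan hM (p : PolyUV K 3) (le_sliceSpan h1)) p.2
  obtain ⟨z, hz, e⟩ := h
  rwa [← Subtype.ext (e : (z : PolyUV K 3) = p)]

end

/-! ### Generators, relations and basis of the module `(F_3')^δ` -/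

section

variable (K : Type*) [Field K]

theorem derComm_commutator (p q : F K 3) : derComm (cell3 K) (commutator p q) =
    commutator (der (cell3 K) p) q + commutator p (der (cell3 K) q) := by
  ext
  simp only [derComm, LinearMap.coe_restrict_apply, commutator, map_sub, der_mul, Submodule.coe_add]
  abel

theorem derComm_x₂₁ : derComm (cell3 K) (x₂₁ K) = 0 := by
  rw [x₂₁, derComm_commutator, der_x₁, der_x₂]
  ext; simp [commutator]
theorem derComm_x₃₁ : derComm (cell3 K) (x₃₁ K) = x₂₁ K := by
  rw [x₃₁, derComm_commutator, der_x₁, der_x₃]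
  ext; simp [commutator, x₂₁]
theorem derComm_x₃₂ : derComm (cell3 K) (x₃₂ K) = x₃₁ K := by
  rw [x₃₂, derComm_commutator, der_x₂, der_x₃]
  ext; simp [commutator, x₃₁]

theorem mem_commConst {w : commIdeal K 3} :
    w ∈ commConst (cell3 K) ↔ derComm (cell3 K) w = 0 :=
  ⟨fun h => Subtype.ext h, fun h => congrArg Subtype.val h⟩

theorem c_mem_commConst (j : Fin 5) : c K j ∈ commConst (cell3 K) := by
  rw [mem_commConst]
  fin_cases j
  · exact derComm_x₂₁ K
  all_goals
    simp only [c, c₂, c₃, c₄, c₅, Fin.mk_one, Fin.reduceFinMk, Matrix.cons_val, map_sub, map_add,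
      derComm_smul, Derivation.leibniz, derComm_x₂₁,
      derComm_x₃₁, derComm_x₃₂, polyDer_u₁, polyDer_u₂, polyDer_u₃, polyDer_v₁, polyDer_v₂,
      polyDer_v₃, smul_eq_mul]
    module

section NormalVectors

variable {K} {A : Type*} [CommRing A] [Algebra K A] (g : Fin 6 → A)

/-- The vectors `g_1^{m_1} ⋯ g_5^{m_5} e_j`, without `g_2` for `j = 5`. -/
def monomialVector (a : {a : Fin 5 × (Fin 5 → ℕ) // a.1 = 4 → a.2 1 = 0}) : Fin 5 → A :=
  (∏ i : Fin 5, g i.castSucc ^ a.1.2 i) • Pi.single a.1.1 1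

/-- The six relation vectors with entries in the subring generated by the family `g`. -/
def relationVector : Fin 6 → Fin 5 → A :=
  ![![g 5, g 0, -g 1, 0, 0],
    ![g 0 * g 3 + g 1 * g 4, g 5, 0, -g 1 ^ 2, 0],
    ![-(g 0 * g 4 + g 1 * g 2), 0, g 5, -(g 0 * g 1), 0],
    ![0, -g 2, -g 4, g 5, -g 0],
    ![0, -g 4, -g 3, 0, g 1],
    ![-(g 2 * g 3 - g 4 ^ 2), 0, 0, -(g 0 * g 3 + g 1 * g 4), g 5]]

theorem mul_prod_pow (i : Fin 5) (m : Fin 5 → ℕ) :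
    g i.castSucc * ∏ j : Fin 5, g j.castSucc ^ m j =
      ∏ j : Fin 5, g j.castSucc ^ (Pi.single i 1 + m : Fin 5 → ℕ) j := by
  simp only [Pi.add_apply, pow_add, Finset.prod_mul_distrib]
  congr 1
  rw [Finset.prod_eq_single i (fun j _ hj => by simp [hj]) (by simp)]
  simp

/-- The six relations as rewriting rules: modulo relation vectors they eliminate `f₆` from every
basis vector and `f₂` from the fifth. -/
theorem single_relations {A : Type*} [CommRing A] (f₁ f₂ f₃ f₄ f₅ f₆ : A) :
    (f₆ • Pi.single 0 1 : Fin 5 → A) =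
        f₂ • Pi.single 2 1 - f₁ • Pi.single 1 1 + ![f₆, f₁, -f₂, 0, 0] ∧
    (f₆ • Pi.single 1 1 : Fin 5 → A) =
        f₂ • f₂ • Pi.single 3 1 - f₁ • f₄ • Pi.single 0 1 - f₂ • f₅ • Pi.single 0 1 +
          ![f₁ * f₄ + f₂ * f₅, f₆, 0, -f₂ ^ 2, 0] ∧
    (f₆ • Pi.single 2 1 : Fin 5 → A) =
        f₁ • f₂ • Pi.single 3 1 + f₁ • f₅ • Pi.single 0 1 + f₂ • f₃ • Pi.single 0 1 +
          ![-(f₁ * f₅ + f₂ * f₃), 0, f₆, -(f₁ * f₂), 0] ∧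
    (f₆ • Pi.single 3 1 : Fin 5 → A) =
        f₃ • Pi.single 1 1 + f₅ • Pi.single 2 1 + f₁ • Pi.single 4 1 +
          ![0, -f₃, -f₅, f₆, -f₁] ∧
    (f₂ • Pi.single 4 1 : Fin 5 → A) =
        f₅ • Pi.single 1 1 + f₄ • Pi.single 2 1 + ![0, -f₅, -f₄, 0, f₂] ∧
    (f₆ • Pi.single 4 1 : Fin 5 → A) =
        f₃ • f₄ • Pi.single 0 1 - f₅ • f₅ • Pi.single 0 1 + f₁ • f₄ • Pi.single 3 1 +
          f₂ • f₅ • Pi.single 3 1 +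
          ![-(f₃ * f₄ - f₅ ^ 2), 0, 0, -(f₁ * f₄ + f₂ * f₅), f₆] := by
  refine ⟨?_, ?_, ?_, ?_, ?_, ?_⟩ <;> funext i <;> fin_cases i <;> simp
  all_goals ring

theorem span_monomialVector_sup (hg : (aeval g : MvPolynomial (Fin 6) K →ₐ[K] A).range = ⊤) :
    Submodule.span K (Set.range (monomialVector g)) ⊔
    (Submodule.span (A) (Set.range (relationVector g))).restrictScalars K = ⊤ := by
  set J := Submodule.span (A) (Set.range (relationVector g)) with hJ
  set T := Submodule.span K (Set.range (monomialVector g)) ⊔ J.restrictScalars K with hT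
  have hm : ∀ a, monomialVector g a ∈ T := fun a =>
    Submodule.mem_sup_left (Submodule.subset_span ⟨a, rfl⟩)
  obtain ⟨e0, e1, e2, e3, e5, e4⟩ := single_relations (g 0) (g 1) (g 2) (g 3) (g 4) (g 5)
  have hr : ∀ i, ∀ p : A, p • relationVector g i ∈ T := fun i p =>
    Submodule.mem_sup_right (J.smul_mem p (Submodule.subset_span ⟨i, rfl⟩))
  have hr1 : ∀ i, relationVector g i ∈ T := fun i => by simpa using hr i 1
  have hshift : ∀ (i j : Fin 5) (m : Fin 5 → ℕ) (h : j = 4 → m 1 = 0) (h' : j = 4 → i ≠ 1),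
      g i.castSucc • monomialVector g ⟨(j, m), h⟩ ∈ T := by
    intro i j m h h'
    rw [monomialVector, smul_smul, mul_prod_pow]
    refine hm ⟨(j, Pi.single i 1 + m), fun e => ?_⟩
    simp [h e, (h' e).symm]
  -- Only the fifth basis vector obstructs multiplication by `g 1`; there the fifth relation moves
  -- the product to the second and third vectors, which carry no restriction.
  have h2 : ∀ w ∈ T, g 1 • w ∈ T := by
    refine fun w hw => smul_mem_span_sup ?_ hw
    rintro ⟨⟨j, m⟩, h⟩
    by_cases hj : j = 4
    · subst hj
      have e : g 1 • monomialVector g ⟨(4, m), h⟩ = g 4 • monomialVector g ⟨(1, m), by simp⟩ +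
          g 3 • monomialVector g ⟨(2, m), by simp⟩ + (∏ j : Fin 5, g j.castSucc ^ m j) • relationVector g 4 := by
        simp only [monomialVector]
        rw [smul_comm, e5]
        change _ = _ + _ + (∏ j : Fin 5, g j.castSucc ^ m j) • ![0, -g 4, -g 3, 0, g 1]
        module
      rw [e]
      exact Submodule.add_mem _ (Submodule.add_mem _ (hshift 4 1 m _ (by simp))
        (hshift 3 2 m _ (by simp))) (hr 4 _)
    · exact hshift 1 j m h (fun e => absurd e hj)
  have hf : ∀ i : Fin 5, ∀ w ∈ T, g i.castSucc • w ∈ T := by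
    intro i
    by_cases hi : i = 1
    · subst hi; exact h2
    · exact fun w hw => smul_mem_span_sup (fun ⟨⟨j, m⟩, h⟩ => hshift i j m h fun _ => hi) hw
  have h1 : ∀ w ∈ T, g 0 • w ∈ T := hf 0
  have h3 : ∀ w ∈ T, g 2 • w ∈ T := hf 2
  have h4 : ∀ w ∈ T, g 3 • w ∈ T := hf 3
  have h5 : ∀ w ∈ T, g 4 • w ∈ T := hf 4
  have hsingle : ∀ j, Pi.single j 1 ∈ T := fun j => by
    have := hm ⟨(j, 0), by simp⟩
    simpa [monomialVector] using this
  -- For `g 5` it suffices to treat the basis vectors: the monomial factors commute past it and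
  -- already preserve `T`.
  have h6single : ∀ j, g 5 • Pi.single j 1 ∈ T := by
    intro j
    fin_cases j <;> simp only [Fin.mk_one, Fin.reduceFinMk, Fin.zero_eta]
    · rw [e0]; exact T.add_mem (T.sub_mem (h2 _ (hsingle 2)) (h1 _ (hsingle 1))) (hr1 0)
    · rw [e1]; exact T.add_mem (T.sub_mem (T.sub_mem (h2 _ (h2 _ (hsingle 3)))
        (h1 _ (h4 _ (hsingle 0)))) (h2 _ (h5 _ (hsingle 0)))) (hr1 1)
    · rw [e2]; exact T.add_mem (T.add_mem (T.add_mem (h1 _ (h2 _ (hsingle 3)))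
        (h1 _ (h5 _ (hsingle 0)))) (h2 _ (h3 _ (hsingle 0)))) (hr1 2)
    · rw [e3]; exact T.add_mem (T.add_mem (T.add_mem (h3 _ (hsingle 1))
        (h5 _ (hsingle 2))) (h1 _ (hsingle 4))) (hr1 3)
    · rw [e4]; exact T.add_mem (T.add_mem (T.add_mem (T.sub_mem (h3 _ (h4 _ (hsingle 0)))
        (h5 _ (h5 _ (hsingle 0)))) (h1 _ (h4 _ (hsingle 3)))) (h2 _ (h5 _ (hsingle 3)))) (hr1 5)
  have hmon : ∀ (m : Fin 5 → ℕ), ∀ w ∈ T, (∏ j : Fin 5, g j.castSucc ^ m j) • w ∈ T := by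
    have hpow : ∀ (p : A), (∀ w ∈ T, p • w ∈ T) → ∀ n : ℕ, ∀ w ∈ T,
        p ^ n • w ∈ T := by
      intro p hp n
      induction n with
      | zero => intro w hw; simpa using hw
      | succ n ih => intro w hw; rw [pow_succ, mul_smul]; exact ih _ (hp _ hw)
    intro m w hw
    rw [Fin.prod_univ_five]
    simp only [mul_smul]
    exact hpow _ h1 _ _ (hpow _ h2 _ _ (hpow _ h3 _ _ (hpow _ h4 _ _ (hpow _ h5 _ _ hw))))
  have h6 : ∀ w ∈ T, g 5 • w ∈ T := by
    refine fun w hw => smul_mem_span_sup ?_ hw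
    rintro ⟨⟨j, m⟩, h⟩
    rw [monomialVector, smul_comm]
    exact hmon m _ (h6single j)
  have h7 : ∀ i : Fin 6, ∀ w ∈ T, g i • w ∈ T := fun i =>
    Fin.lastCases (motive := fun i => ∀ w ∈ T, g i • w ∈ T) h6 hf i
  have hall : ∀ p : A, ∀ w ∈ T, p • w ∈ T := by
    intro p
    obtain ⟨p, rfl⟩ := (AlgHom.range_eq_top _).1 (hg) p
    induction p using MvPolynomial.induction_on with
    | C a =>
      intro w hw
      rw [← algebraMap_eq, AlgHom.commutes, algebraMap_smul]
      exact T.smul_mem _ hw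
    | add p q hp hq =>
      intro w hw
      rw [map_add, add_smul]; exact T.add_mem (hp w hw) (hq w hw)
    | mul_X p i hp =>
      intro w hw
      rw [map_mul, mul_smul, aeval_X]; exact hp _ (h7 i w hw)
  rw [eq_top_iff]
  rintro s -
  have e : s = ∑ j, s j • Pi.single j 1 := by
    funext i
    simp [Pi.single_apply]
  rw [e]
  exact T.sum_mem fun j _ => hall _ _ (hsingle j)

end NormalVectors

theorem relation_eq : relation K = relationVector (f K) := rfl

theorem linearCombination_monomialVector (a : {a : Fin 5 × (Fin 5 → ℕ) // a.1 = 4 → a.2 1 = 0}) :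
    Fintype.linearCombination (polyConst (cell3 K)) (c K) (monomialVector (f K) a) = commBasis K a := by
  rw [monomialVector, map_smul, Fintype.linearCombination_apply_single, one_smul]
  rfl

theorem linearCombination_relation (i : Fin 6) :
    Fintype.linearCombination (polyConst (cell3 K)) (c K) (relation K i) = 0 := by
  obtain ⟨h1, h2, h3, h4, h5, h6⟩ := relations K
  rw [Fintype.linearCombination_apply, Fin.sum_univ_five]
  fin_cases i <;> simp only [relation, c, Fin.mk_one, Fin.reduceFinMk, Fin.zero_eta, Matrix.cons_val]
  · linear_combination (norm := module) h1
  · linear_combination (norm := module) h2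
  · linear_combination (norm := module) h3
  · linear_combination (norm := module) h4
  · linear_combination (norm := module) h5
  · linear_combination (norm := module) h6

theorem ker_linearCombination_c [CharZero K] :
    LinearMap.ker (Fintype.linearCombination (polyConst (cell3 K)) (c K)) =
      Submodule.span (polyConst (cell3 K)) (Set.range (relation K)) := by
  have hle : Submodule.span (polyConst (cell3 K)) (Set.range (relation K)) ≤
      LinearMap.ker (Fintype.linearCombination (polyConst (cell3 K)) (c K)) := by
    rw [Submodule.span_le]
    rintro _ ⟨i, rfl⟩
    exact linearCombination_relation K i
  refine le_antisymm (fun w hw => ?_) hle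
  exact ker_le_of_linearIndependent
    (φ := (Fintype.linearCombination (polyConst (cell3 K)) (c K)).restrictScalars K)
    (m := monomialVector (f K))
    (J := (Submodule.span (polyConst (cell3 K)) (Set.range (relation K))).restrictScalars K)
    (linearIndependent_congr (linearIndependent_commBasis K) (linearCombination_monomialVector K))
    (fun w hw => hle hw) (span_monomialVector_sup (f K) (range_aeval_f K)) hw

theorem span_commBasis_eq_span_c [CharZero K] : Submodule.span K (Set.range (commBasis K)) =
    (Submodule.span (polyConst (cell3 K)) (Set.range (c K))).restrictScalars K := by
  have h := congrArg (Submodule.map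
    ((Fintype.linearCombination (polyConst (cell3 K)) (c K)).restrictScalars K))
    (span_monomialVector_sup (f K) (range_aeval_f K))
  rw [← relation_eq] at h
  have h0 : Submodule.map
      ((Fintype.linearCombination (polyConst (cell3 K)) (c K)).restrictScalars K)
      ((Submodule.span (polyConst (cell3 K)) (Set.range (relation K))).restrictScalars K) = ⊥ := by
    rw [eq_bot_iff]
    rintro _ ⟨w, hw, rfl⟩
    rw [← ker_linearCombination_c] at hw
    exact hw
  have e : (Fintype.linearCombination (polyConst (cell3 K)) (c K)).restrictScalars K ∘
      monomialVector (f K) = commBasis K := _root_.funext (linearCombination_monomialVector K)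
  rw [Submodule.map_sup, Submodule.map_span, ← Set.range_comp, Submodule.map_top, h0,
    sup_bot_eq, e] at h
  rw [h, ← Fintype.range_linearCombination]
  rfl

/-- The slice argument again. The slice span `S` is a `K[U_3,V_3]`-submodule containing `x₂₁ = c₁`;
dividing by `u₁` in the definitions of `c₃` and `c₄` gives `x₃₁` and `x₃₂`, so `S` is all of `F_3'`.
-/
theorem span_c [CharZero K] :
    Submodule.span (polyConst (cell3 K)) (Set.range (c K)) = commConst (cell3 K) := by
  set A := Submodule.span (polyConst (cell3 K)) (Set.range (c K)) with hA
  have hle : A ≤ commConst (cell3 K) := by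
    rw [hA, Submodule.span_le]
    rintro _ ⟨j, rfl⟩
    exact c_mem_commConst K j
  refine le_antisymm hle fun w hw => ?_
  have hc : ∀ j, c K j ∈ A := fun j => Submodule.subset_span ⟨j, rfl⟩
  have hM : ∀ i, ∀ w ∈ A.restrictScalars K, (f K i : PolyUV K 3) • w ∈ A.restrictScalars K :=
    fun i w hw => A.smul_mem (f K i) hw
  let S : Submodule (PolyUV K 3) (commIdeal K 3) :=
    { sliceSpan (u₂ K) (u₁ K) (A.restrictScalars K) (hM 0) with
      smul_mem' := fun p w hw => smul_mem_sliceSpan hM p hw }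
  have hcS : ∀ j, c K j ∈ S := fun j => le_sliceSpan (hM := hM 0) (hc j)
  have hdiv : ∀ w, u₁ K • w ∈ S → w ∈ S := fun w hw => mem_sliceSpan_of_smul_mem (hM := hM 0) hw
  have h21 : x₂₁ K ∈ S := hcS 0
  have h31 : x₃₁ K ∈ S := by
    refine hdiv _ ?_
    have e : u₁ K • x₃₁ K = c K 2 + u₂ K • x₂₁ K := by
      change _ = u₁ K • x₃₁ K - u₂ K • x₂₁ K + _
      abel
    exact e ▸ S.add_mem (hcS 2) (S.smul_mem _ h21)
  have h32 : x₃₂ K ∈ S := by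
    refine hdiv _ ?_
    have e : u₁ K • x₃₂ K = c K 3 + u₂ K • x₃₁ K - u₃ K • x₂₁ K := by
      change _ = u₁ K • x₃₂ K - u₂ K • x₃₁ K + u₃ K • x₂₁ K + _ - _
      abel
    exact e ▸ S.sub_mem (S.add_mem (hcS 3) (S.smul_mem _ h31)) (S.smul_mem _ h21)
  have htop := eq_top_of_mem K h21 h31 h32
  refine mem_of_mem_sliceSpan (D := (derComm (cell3 K)).toAddMonoidHom) (δ := polyDer (cell3 K))
    (s := u₂ K) (u := u₁ K) (M := A.restrictScalars K) (hM := hM 0) (derComm_smul _)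
    (polyDer_u₂ K) (polyDer_u₁ K) (fun w => u₁_smul_eq_zero K)
    (fun w hw => (mem_commConst K).1 (hle hw)) (fun w _ hw => ?_)
    (show w ∈ S from htop ▸ Submodule.mem_top) ((mem_commConst K).1 hw)
  rw [← span_commBasis_eq_span_c] at hw ⊢
  exact mem_span_commBasis_of_smul_mem K hw

end

/-! ### Generators of the algebra `F_3^δ` -/

section

section Abelianization

variable (K : Type*) [Field K] (d : ℕ)

/-- The map from `F_d` onto `K[U_d]` which sends `x_i` to `u_i`. -/
def abelianize : F K d →ₐ[K] PolyUV K d :=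
  liftF (fun i => X (Sum.inl i)) fun p q r s => by rw [mul_comm q p, sub_self, zero_mul]

theorem abelianize_x (i : Fin d) : abelianize K d (x K d i) = X (Sum.inl i) := by
  rw [abelianize, liftF_x]

variable {K d}

theorem mem_commIdeal_of_abelianize_eq_zero {w : F K d} (hw : abelianize K d w = 0) :
    w ∈ commIdeal K d := by
  let I : Ideal (F K d) := TwoSidedIdeal.asIdeal
    (TwoSidedIdeal.span {w : F K d | ∃ p q : F K d, w = p * q - q * p})
  let π := Ideal.Quotient.mkₐ K I
  -- The projection onto `F_d / F_d'` factors through `abelianize`: map `u_i` to the class of `x_i`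
  -- and `v_i` to zero, the classes of the `x_i` being pairwise commuting.
  let g : Fin d ⊕ Fin d → F K d ⧸ I := Sum.elim (fun i => π (x K d i)) 0
  have hg : ∀ s t, g s * g t = g t * g s := by
    rintro (i | i) (j | j)
    · simp only [g, Sum.elim_inl, ← map_mul]
      exact (Ideal.Quotient.eq (I := I)).2 (comm_mem (x K d i) (x K d j))
    all_goals simp [g]
  have h : (commAeval (K := K) g hg).comp (abelianize K d) = π := hom_ext fun i => by
    rw [AlgHom.comp_apply, abelianize_x, commAeval_X]
    rfl
  have h1 : π w = 0 := by rw [← h, AlgHom.comp_apply, hw, map_zero]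
  exact (Ideal.Quotient.eq_zero_iff_mem (I := I)).1 h1

theorem abelianize_der (α : Matrix (Fin d) (Fin d) K) (w : F K d) :
    abelianize K d (der α w) = polyDer α (abelianize K d w) := by
  induction w using F_induction with
  | hC a =>
    have h : der α (algebraMap K (F K d) a) = 0 := (algConst α).algebraMap_mem a
    rw [h, AlgHom.commutes, Derivation.map_algebraMap, map_zero]
  | hx i =>
    rw [der_x, abelianize_x, polyDer, mkDerivation_X]
    simp [abelianize_x]
  | hadd a b ha hb => simp only [map_add, ha, hb]
  | hmul a b ha hb =>
    rw [der_mul, map_add, map_mul, map_mul, map_mul, ha, hb, Derivation.leibniz]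
    simp only [smul_eq_mul]
    ring

end Abelianization

variable (K : Type*) [Field K]

/-- The constant `x_2^2 - (x_1 x_3 + x_3 x_1)` of `F_3`. -/
def quadric : F K 3 := x K 3 1 ^ 2 - (x K 3 0 * x K 3 2 + x K 3 2 * x K 3 0)

theorem der_quadric : der (cell3 K) (quadric K) = 0 := by
  simp only [quadric, pow_two, map_sub, map_add, der_mul, der_x₁, der_x₂, der_x₃]
  noncomm_ring

theorem x_mul_coe (w : commIdeal K 3) (i : Fin 3) :
    x K 3 i * (w : F K 3) = ((X (Sum.inl i) : PolyUV K 3) • w : commIdeal K 3) :=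
  (u_smul i w).symm

theorem coe_mul_x (w : commIdeal K 3) (i : Fin 3) : (w : F K 3) * x K 3 i =
    ((X (Sum.inl i) + X (Sum.inr i) : PolyUV K 3) • w : commIdeal K 3) := by
  rw [add_smul, Submodule.coe_add, u_smul, v_smul]
  abel

theorem quadric_mul_coe (w : commIdeal K 3) :
    quadric K * (w : F K 3) = (f₃ K • w : commIdeal K 3) := by
  simp only [quadric, sub_mul, add_mul, pow_two, mul_assoc, x_mul_coe]
  rw [← Submodule.coe_add, ← Submodule.coe_sub]
  congr 1
  change _ = (u₂ K ^ 2 - 2 * u₁ K * u₃ K) • w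
  simp only [u₁, u₂, u₃]
  module

/-- Right multiplication by `x_i` is `u_i + v_i`, so this is `f₃` polarized at `U + V`; the mixed
terms give `-2 f₅`. -/
theorem coe_mul_quadric (w : commIdeal K 3) :
    (w : F K 3) * quadric K = (f₃ K • w + f₄ K • w - (2 : K) • f₅ K • w : commIdeal K 3) := by
  simp only [quadric, mul_sub, mul_add, pow_two, ← mul_assoc, coe_mul_x]
  rw [← Submodule.coe_add, ← Submodule.coe_sub]
  congr 1
  rw [← algebraMap_smul (PolyUV K 3) (2 : K), map_ofNat]
  change _ = (u₂ K ^ 2 - 2 * u₁ K * u₃ K) • w + (v₂ K ^ 2 - 2 * v₁ K * v₃ K) • w -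
    (2 : PolyUV K 3) • (u₁ K * v₃ K - u₂ K * v₂ K + u₃ K * v₁ K) • w
  simp only [u₁, u₂, u₃, v₁, v₂, v₃]
  module

theorem infinite_algGenerators [CharZero K] : (algGenerators K).Infinite := by
  have hinj : Function.Injective fun p : ℕ => ((f₅ K ^ p • c K 0 : commIdeal K 3) : F K 3) := by
    intro p q h
    have e : ∀ p : ℕ, commBasis K ⟨(0, Pi.single 4 p), by simp⟩ = f₅ K ^ p • c K 0 := fun p => by
      simp [commBasis, fMonomial_eq]
    have h' := Subtype.ext h
    rw [← e, ← e] at h'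
    have h2 := (linearIndependent_commBasis K).injective h'
    have h3 := congrArg (fun z => z.1.2 4) h2
    simpa using h3
  exact Set.infinite_of_injective_forall_mem hinj fun p => Or.inr ⟨0, p, rfl⟩

theorem adjoin_algGenerators_le : Algebra.adjoin K (algGenerators K) ≤ algConst (cell3 K) := by
  rw [Algebra.adjoin_le_iff]
  rintro w ((rfl | rfl) | ⟨j, p, rfl⟩)
  · exact der_x₁ K
  · exact der_quadric K
  · exact (commConst (cell3 K)).smul_mem _ (c_mem_commConst K j)

theorem commBasis_mem_adjoin (a : {a : Fin 5 × (Fin 5 → ℕ) // a.1 = 4 → a.2 1 = 0}) :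
    (commBasis K a : F K 3) ∈ Algebra.adjoin K (algGenerators K) := by
  set B := Algebra.adjoin K (algGenerators K) with hB
  -- Quantifying over all `p` makes `T` stable under `f₅` by a shift of the exponent; the generators
  -- `c_j f₅ ^ p` place every `c_j` in `T`.
  let T : Set (commIdeal K 3) := {w | ∀ p : ℕ, ((f₅ K ^ p • w : commIdeal K 3) : F K 3) ∈ B}
  have hx : x K 3 0 ∈ B := Algebra.subset_adjoin (Or.inl (Or.inl rfl))
  have hq : quadric K ∈ B := Algebra.subset_adjoin (Or.inl (Or.inr rfl))
  have h1 : ∀ w ∈ T, f₁ K • w ∈ T := fun w hw p => by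
    rw [smul_comm]
    have := B.mul_mem hx (hw p)
    rwa [x_mul_coe] at this
  have h2 : ∀ w ∈ T, f₂ K • w ∈ T := fun w hw p => by
    rw [smul_comm]
    have := B.sub_mem (B.mul_mem (hw p) hx) (B.mul_mem hx (hw p))
    rwa [← v_smul] at this
  have h3 : ∀ w ∈ T, f₃ K • w ∈ T := fun w hw p => by
    rw [smul_comm]
    have := B.mul_mem hq (hw p)
    rwa [quadric_mul_coe] at this
  have h5 : ∀ w ∈ T, f₅ K • w ∈ T := fun w hw p => by
    rw [← mul_smul, ← pow_succ]
    exact hw (p + 1)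
  have h4 : ∀ w ∈ T, f₄ K • w ∈ T := fun w hw p => by
    rw [smul_comm]
    have h := B.mul_mem (hw p) hq
    rw [coe_mul_quadric] at h
    have h3' := h3 w hw p
    have h5' := B.smul_mem (h5 w hw p) (2 : K)
    rw [smul_comm] at h3' h5'
    rw [← Submodule.coe_smul] at h5'
    have := B.sub_mem (B.add_mem h h5') h3'
    rw [← Submodule.coe_add, ← Submodule.coe_sub] at this
    convert this using 2
    abel
  have hc : c K a.1.1 ∈ T := fun p => Algebra.subset_adjoin (Or.inr ⟨_, p, rfl⟩)
  have hpow : ∀ (p : polyConst (cell3 K)), (∀ w ∈ T, p • w ∈ T) → ∀ n : ℕ, ∀ w ∈ T,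
      p ^ n • w ∈ T := by
    intro p hp n
    induction n with
    | zero => intro w hw; simpa using hw
    | succ n ih => intro w hw; rw [pow_succ, mul_smul]; exact ih _ (hp _ hw)
  have h : commBasis K a ∈ T := by
    rw [commBasis, fMonomial_eq]
    simp only [mul_smul]
    exact hpow _ h1 _ _ (hpow _ h2 _ _ (hpow _ h3 _ _ (hpow _ h4 _ _ (hpow _ h5 _ _ hc))))
  simpa using h 0

theorem coe_mem_adjoin_of_mem_commConst [CharZero K] {w : commIdeal K 3}
    (hw : w ∈ commConst (cell3 K)) : (w : F K 3) ∈ Algebra.adjoin K (algGenerators K) := by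
  rw [← span_c] at hw
  have hw' : w ∈ Submodule.span K (Set.range (commBasis K)) := by
    rw [span_commBasis_eq_span_c]; exact hw
  clear hw
  induction hw' using Submodule.span_induction with
  | mem w hw => obtain ⟨a, rfl⟩ := hw; exact commBasis_mem_adjoin K a
  | zero => exact Subalgebra.zero_mem _
  | add a b _ _ ha hb => exact Subalgebra.add_mem _ ha hb
  | smul r a _ ha => exact Subalgebra.smul_mem _ ha r

theorem exists_mem_adjoin_abelianize_eq [CharZero K] {w : F K 3} (hw : w ∈ algConst (cell3 K)) :
    ∃ a ∈ Algebra.adjoin K (algGenerators K), abelianize K 3 a = abelianize K 3 w := by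
  have hp : polyDer (cell3 K) (abelianize K 3 w) = 0 := by
    have hw' : der (cell3 K) w = 0 := hw
    rw [← abelianize_der, hw', map_zero]
  obtain ⟨P, hP⟩ := (AlgHom.range_eq_top _).1 (range_aeval_f K) ⟨_, hp⟩
  -- Setting `V = 0` fixes the image of `abelianize` and kills every `f_i` except `f₁` and `f₃`.
  let θ : PolyUV K 3 →ₐ[K] PolyUV K 3 := aeval (Sum.elim (fun i => X (Sum.inl i)) 0)
  have hθ : θ.comp (abelianize K 3) = abelianize K 3 := hom_ext fun i => by
    rw [AlgHom.comp_apply, abelianize_x]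
    simp [θ]
  set B := (Algebra.adjoin K (algGenerators K)).map (abelianize K 3) with hB
  have hu1 : u₁ K ∈ B :=
    ⟨x K 3 0, Algebra.subset_adjoin (Or.inl (Or.inl rfl)), abelianize_x K 3 0⟩
  have hf3 : (f₃ K : PolyUV K 3) ∈ B := by
    refine ⟨quadric K, Algebra.subset_adjoin (Or.inl (Or.inr rfl)), ?_⟩
    change abelianize K 3 (quadric K) = u₂ K ^ 2 - 2 * u₁ K * u₃ K
    simp only [quadric, map_sub, map_add, map_mul, map_pow, abelianize_x, u₁, u₂, u₃]
    ring
  have hθf : ∀ i, θ (f K i) ∈ B := by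
    have tu : ∀ i, θ (X (Sum.inl i)) = X (Sum.inl i) := fun i => by simp [θ]
    have tv : ∀ i, θ (X (Sum.inr i)) = 0 := fun i => by simp [θ]
    intro i
    fin_cases i
    · convert hu1 using 1
      exact tu 0
    · convert B.zero_mem
      exact tv 0
    · convert hf3 using 1
      change θ (u₂ K ^ 2 - 2 * u₁ K * u₃ K) = u₂ K ^ 2 - 2 * u₁ K * u₃ K
      simp only [u₁, u₂, u₃, map_sub, map_mul, map_pow, tu, map_ofNat]
    · convert B.zero_mem
      change θ (v₂ K ^ 2 - 2 * v₁ K * v₃ K) = 0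
      simp [v₁, v₂, tv]
    · convert B.zero_mem
      change θ (u₁ K * v₃ K - u₂ K * v₂ K + u₃ K * v₁ K) = 0
      simp [v₁, v₂, v₃, tv]
    · convert B.zero_mem
      change θ (u₁ K * v₂ K - u₂ K * v₁ K) = 0
      simp [v₁, v₂, tv]
  have hmem : ∀ P : MvPolynomial (Fin 6) K, θ (aeval (f K) P : polyConst (cell3 K)) ∈ B := by
    intro P
    induction P using MvPolynomial.induction_on with
    | C a =>
      rw [← algebraMap_eq, AlgHom.commutes, Subalgebra.coe_algebraMap, AlgHom.commutes]
      exact B.algebraMap_mem a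
    | add p q hp hq => rw [map_add, Subalgebra.coe_add, map_add]; exact B.add_mem hp hq
    | mul_X p i hp =>
      rw [map_mul, aeval_X, Subalgebra.coe_mul, map_mul]
      exact B.mul_mem hp (hθf i)
  have h := hmem P
  rw [hP] at h
  change θ (abelianize K 3 w) ∈ B at h
  rw [← AlgHom.comp_apply, hθ] at h
  exact h

theorem adjoin_algGenerators [CharZero K] :
    Algebra.adjoin K (algGenerators K) = algConst (cell3 K) := by
  refine le_antisymm (adjoin_algGenerators_le K) fun w hw => ?_
  obtain ⟨a, ha, e⟩ := exists_mem_adjoin_abelianize_eq K hw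
  have h : w - a ∈ commIdeal K 3 :=
    mem_commIdeal_of_abelianize_eq_zero (by rw [map_sub, e, sub_self])
  have h1 : (⟨w - a, h⟩ : commIdeal K 3) ∈ commConst (cell3 K) :=
    (algConst (cell3 K)).sub_mem hw (adjoin_algGenerators_le K ha)
  simpa using Subalgebra.add_mem _ (coe_mem_adjoin_of_mem_commConst K h1) ha

end

end FreeMetab

end

open FreeMetab in
theorem mainTheorem4 (K : Type*) [Field K] [CharZero K] :
    -- the algebra `K[U_3,V_3]^δ` and its presentation
    ((MvPolynomial.aeval (f K) :
        MvPolynomial (Fin 6) K →ₐ[K] polyConst (cell3 K)).range = ⊤ ∧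
      RingHom.ker (MvPolynomial.aeval (f K) :
        MvPolynomial (Fin 6) K →ₐ[K] polyConst (cell3 K)) =
        Ideal.span {MvPolynomial.X 5 ^ 2 -
          (MvPolynomial.X 0 ^ 2 * MvPolynomial.X 3 + MvPolynomial.X 1 ^ 2 * MvPolynomial.X 2 +
            2 * MvPolynomial.X 0 * MvPolynomial.X 1 * MvPolynomial.X 4)}) ∧
    -- the basis of the vector space `K[U_3,V_3]^δ`
    (LinearIndependent K
        (fun a : (Fin 5 → ℕ) × Fin 2 => fMonomial K a.1 * f₆ K ^ (a.2 : ℕ)) ∧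
      Submodule.span K
        (Set.range fun a : (Fin 5 → ℕ) × Fin 2 => fMonomial K a.1 * f₆ K ^ (a.2 : ℕ)) = ⊤) ∧
    -- generators of the `K[U_3,V_3]^δ`-module `(F_3')^δ`
    Submodule.span (polyConst (cell3 K)) (Set.range (c K)) = commConst (cell3 K) ∧
    -- the six relations
    (f₆ K • c₁ K = f₂ K • c₃ K - f₁ K • c₂ K ∧
      f₆ K • c₂ K = f₂ K ^ 2 • c₄ K - (f₁ K * f₄ K + f₂ K * f₅ K) • c₁ K ∧
      f₆ K • c₃ K = (f₁ K * f₂ K) • c₄ K + (f₁ K * f₅ K + f₂ K * f₃ K) • c₁ K ∧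
      f₆ K • c₄ K = f₃ K • c₂ K + f₅ K • c₃ K + f₁ K • c₅ K ∧
      f₂ K • c₅ K = f₅ K • c₂ K + f₄ K • c₃ K ∧
      f₆ K • c₅ K = (f₃ K * f₄ K - f₅ K ^ 2) • c₁ K + (f₁ K * f₄ K + f₂ K * f₅ K) • c₄ K) ∧
    -- they are defining relations
    LinearMap.ker (Fintype.linearCombination (polyConst (cell3 K)) (c K)) =
      Submodule.span (polyConst (cell3 K)) (Set.range (relation K)) ∧
    -- the basis of the vector space `(F_3')^δ`
    (LinearIndependent K
        (fun a : {a : Fin 5 × (Fin 5 → ℕ) // a.1 = 4 → a.2 1 = 0} =>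
          fMonomial K a.1.2 • c K a.1.1) ∧
      Submodule.span K
        (Set.range fun a : {a : Fin 5 × (Fin 5 → ℕ) // a.1 = 4 → a.2 1 = 0} =>
          fMonomial K a.1.2 • c K a.1.1) = (commConst (cell3 K)).restrictScalars K) ∧
    -- generators of the algebra `F_3^δ`
    ((algGenerators K).Infinite ∧ Algebra.adjoin K (algGenerators K) = algConst (cell3 K)) := by
  refine ⟨⟨range_aeval_f K, ker_aeval_f K⟩, ⟨linearIndependent_polyBasis K, ?_⟩, span_c K,
    relations K, ker_linearCombination_c K, ⟨linearIndependent_commBasis K, ?_⟩,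
    infinite_algGenerators K, adjoin_algGenerators K⟩
  · exact (span_polyBasis K).trans (by rw [range_aeval_f, Algebra.top_toSubmodule])
  · exact (span_commBasis_eq_span_c K).trans (by rw [span_c])
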